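/- Let $T>0$, $\mathcal I=[0,T]$, and let $g_1,\dots,g_p:\mathcal I\times\mathbb R^d\to\mathbb R$. Put $$Q(t)=\{x\in\mathbb R^d:\ g_i(t,x)\ge 0\ \ \forall i\},\quad \Omega=\{(t,x):t\in\mathcal I,\ x\in Q(t)\},\quad \Omega_i=\{(t,x):t\in\mathcal I,\ g_i(t,x)\ge 0\}.$$ Let $B$ be the closed unit ball of $\mathbb R^{d+1}$, and let neighbourhoods $\Omega+\kappa B$, $\Omega_i+\kappa B$ be understood within $\mathcal I\times\mathbb R^d$ (time derivatives are one-sided at $t=0,T$). Assume that there are $\alpha,\beta,M,\kappa,\rho,\gamma>0$ such that, for every $i$, $g_i$ is $C^2$ on $\Omega+\kappa B$ and, on $\Omega_i+\kappa B$, * (A1) $\alpha\le|\nabla_x g_i|\le\beta$; * (A2) $|\partial_t g_i|\le\beta$; * (A3) $|D_x^2g_i|\le M$; * (A4) $|\partial_t^2g_i|+|\partial_t\nabla_xg_i|\le M$; and such that, with $I_\rho(t,x)=\{i: g_i(t,x)\le\rho\}$, * ($R_\rho$) $\displaystyle\sum_{i\in I_\rho(t,x)}\lambda_i|\nabla_xg_i(t,x)|\le\gamma\Big|\sum_{i\in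 I_\rho(t,x)}\lambda_i\nabla_xg_i(t,x)\Big|$ for all $t\in\mathcal I$, $x\in Q(t)$ and $\lambda_i\ge 0$. Let $f:\mathcal I\times\mathbb R^d\to\mathbb R^d$, $q_0\in\mathrm{Int}\,Q(0)$, $u_0\in\mathbb R^d$. For a set $Q$ and $x\in\mathbb R^d$ let $P_Q(x)=\{y\in Q:|x-y|=d_Q(x)\}$, let $\mathrm N(Q,x)=\{v:\exists s>0,\ x\in P_Q(x+sv)\}$ be the proximal normal cone (empty if $x\notin Q$), and let $\mathcal C_{t,q}=\{\lim_{\epsilon\downarrow0}v_\epsilon:\ q+\epsilon v_\epsilon\in Q(t+\epsilon)\text{ for small }\epsilon>0\}$. The differential measure $du$ on $[0,T]$ of a function $u$ of bounded variation on $[0,T]$ is given by $du([a,b])=u(b^+)-u(a^-)$, with $u(0^-)=u(0)$ and $u(T^+)=u(T)$. Let $q:\mathcal I\to\mathbb R^d$ be continuous, of class $W^{1,\infty}$, and let its weak derivative $\dot q$ have bounded variation (a representative $\dot q:\mathcal I\to\mathbb R^d$ of bounded variation is fixed). In both problems below it is required that $t\mapsto f(t,q(t))$ is integrable on $\mathcal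 I$, that $q(0)=q_0$ and $\dot q(0)=u_0$, and that the impact law $P_{\mathcal C_{t,q(t)}}(\dot q(t^-))=\{\dot q(t^+)\}$ holds for every $t\in(0,T)$. Then the following are equivalent. 1. ($q$ solves $d\dot q+\mathrm N(Q(t),q)\ni f(t,q)\,dt$.) There are $k:\mathcal I\to\mathbb R^d$ of bounded variation and a measurable $\xi:\mathcal I\to\mathbb R^d$ such that $d\dot q+dk=f(t,q(t))\,dt$ as measures on $\mathcal I$, $\xi(s)\in\mathrm N(Q(s),q(s))$ for all $s\in\mathcal I$ (in particular $q(s)\in Q(s)$), $|\xi(s)|=1$ for $d|k|$-almost every $s$, and for all $t\in\mathcal I$ $$|k|(t)=\int_{(0,t]}\mathbf 1_{q(s)\in\partial Q(s)}\,d|k|(s),\qquad k(t)=\int_{(0,t]}\xi(s)\,d|k|(s),$$ where $|k|(t)=\mathrm{Var}(k,[0,t])$ and $d|k|$ is the Stieltjes measure of $|k|$ on $[0,T]$. 2. ($q$ solves the Kuhn–Tucker problem.) $q(t)\in Q(t)$ for all $t\in\mathcal I$, and there are finite nonnegative Borel measures $\lambda_1,\dots,\lambda_p$ on $\mathcal I$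 such that $\mathrm{supp}(\lambda_i)\subset\{t\in\mathcal I:\ g_i(t,q(t))=0\}$ for every $i$ and, as measures on $\mathcal I$, $$d\dot q=f(t,q(t))\,dt+\sum_{i=1}^p\nabla_qg_i(t,q(t))\,d\lambda_i .$$ -/

import Mathlib

open Set Filter Topology MeasureTheory

noncomputable section

namespace SecondOrder

/-! ### Projections, proximal normal cones, admissible velocities -/

section Geometry

variable {E : Type*} [NormedAddCommGroup E] [NormedSpace ℝ E]

/-- The set-valued projection `P_Q(x) = {y ∈ Q : |x - y| = d_Q(x)}`. -/
def proj (Q : Set E) (x : E) : Set E :=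
  {y | y ∈ Q ∧ dist x y = Metric.infDist x Q}

/-- The proximal normal cone `N(Q, x) = {v : ∃ s > 0, x ∈ P_Q(x + s v)}`; it is empty if `x ∉ Q`. -/
def proxNormalCone (Q : Set E) (x : E) : Set E :=
  {v | ∃ s : ℝ, 0 < s ∧ x ∈ proj Q (x + s • v)}

/-- The admissible velocities of a moving set `C` at `(t, q)`: all the limits, as `ε ↓ 0`, of
families `v_ε` with `q + ε v_ε ∈ C (t + ε)`. -/
def admissibleVelocities (C : ℝ → Set E) (t : ℝ) (q : E) : Set E :=
  {v | ∃ w : ℝ → E, (∀ᶠ ε in 𝓝[>] (0 : ℝ), q + ε • w ε ∈ C (t + ε)) ∧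
    Tendsto w (𝓝[>] (0 : ℝ)) (𝓝 v)}

end Geometry

/-! ### Functions of bounded variation on `[0, T]` and their differential measures -/

section BV

variable {E : Type*} [NormedAddCommGroup E]

/-- The retraction of the real line onto `[0, T]`. -/
def clamp (T t : ℝ) : ℝ := max 0 (min t T)

lemma clamp_monotone (T : ℝ) : Monotone (clamp T) := fun _ _ h =>
  max_le_max le_rfl (min_le_min h le_rfl)

lemma clamp_mem {T : ℝ} (hT : 0 ≤ T) (t : ℝ) : clamp T t ∈ Icc 0 T :=
  ⟨le_max_left _ _, max_le hT (min_le_right _ _)⟩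

lemma clamp_of_neg {T : ℝ} (hT : T < 0) (t : ℝ) : clamp T t = 0 :=
  max_eq_left ((min_le_right _ _).trans hT.le)

lemma bv_comp_clamp {T : ℝ} {u : ℝ → E} (hu : BoundedVariationOn u (Icc 0 T)) :
    BoundedVariationOn (u ∘ clamp T) univ := by
  rcases le_or_gt 0 T with hT | hT
  · exact ne_top_of_le_ne_top hu (eVariationOn.comp_le_of_monotoneOn u (clamp T)
      ((clamp_monotone T).monotoneOn _) (fun t _ => clamp_mem hT t))
  · have h : u ∘ clamp T = fun _ => u 0 := by
      funext t
      simp [clamp_of_neg hT t]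
    rw [h, BoundedVariationOn, eVariationOn.constant_on]
    · simp
    · rintro _ ⟨_, _, rfl⟩ _ ⟨_, _, rfl⟩
      rfl

/-- The differential measure `du` on `[0, T]` of a function `u` of bounded variation on `[0, T]`:
`du([a, b]) = u(b⁺) - u(a⁻)` for `0 ≤ a ≤ b ≤ T`, with the usual conventions `u(0⁻) = u(0)` and
`u(T⁺) = u(T)`. It is the vector measure of the extension of `u` that is constant outside
`[0, T]`, so it vanishes outside `[0, T]`. -/
def differentialMeasure [CompleteSpace E] {T : ℝ} {u : ℝ → E}
    (hu : BoundedVariationOn u (Icc 0 T)) : VectorMeasure ℝ E :=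
  (bv_comp_clamp hu).vectorMeasure

/-- The variation function `|k|(t) = Var(k, [0, t])`. -/
def variationFun (k : ℝ → E) (t : ℝ) : ℝ := (eVariationOn k (Icc 0 t)).toReal

lemma monotone_variationFun_clamp {T : ℝ} {k : ℝ → E} (hk : BoundedVariationOn k (Icc 0 T)) :
    Monotone (variationFun k ∘ clamp T) := by
  intro s t hst
  refine ENNReal.toReal_mono ?_ (eVariationOn.mono k (Icc_subset_Icc_right (clamp_monotone T hst)))
  rcases le_or_gt 0 T with hT | hT
  · exact hk.mono (Icc_subset_Icc_right (clamp_mem hT t).2)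
  · rw [clamp_of_neg hT t, Icc_self]
    simp

/-- The measure `d|k|` on `[0, T]`: the Stieltjes measure of the nondecreasing function `|k|`
(extended by constants outside `[0, T]`). -/
def variationMeasure {T : ℝ} {k : ℝ → E} (hk : BoundedVariationOn k (Icc 0 T)) : Measure ℝ :=
  (monotone_variationFun_clamp hk).stieltjesFunction.measure

end BV

/-! ### Trajectories and the abstract second order differential inclusion -/

section Inclusion

variable {E : Type*} [NormedAddCommGroup E] [NormedSpace ℝ E]

/-- `u` is the weak derivative of `q` on `(0, T)`. -/
def HasWeakDeriv (T : ℝ) (q u : ℝ → E) : Prop :=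
  ∀ φ : ℝ → ℝ, ContDiff ℝ (⊤ : ℕ∞) φ → HasCompactSupport φ → tsupport φ ⊆ Ioo 0 T →
    ∫ t in (0 : ℝ)..T, deriv φ t • q t = -∫ t in (0 : ℝ)..T, φ t • u t

/-- `q` is a continuous function of class `W^{1,∞}` on `[0, T]` whose derivative is of bounded
variation; `u` is a representative of bounded variation of `q̇`. -/
structure IsTrajectory (T : ℝ) (q u : ℝ → E) : Prop where
  continuousOn : ContinuousOn q (Icc 0 T)
  memLp : MemLp q ⊤ (volume.restrict (Icc 0 T))
  memLp_deriv : MemLp u ⊤ (volume.restrict (Icc 0 T))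
  weakDeriv : HasWeakDeriv T q u
  bv : BoundedVariationOn u (Icc 0 T)

/-- The measure `f(t, q(t)) dt` on `[0, T]`. -/
def forceMeasure (T : ℝ) (f : ℝ → E → E) (q : ℝ → E) : VectorMeasure ℝ E :=
  (volume.restrict (Icc 0 T)).withDensityᵥ fun t => f t (q t)

/-- The impact law `q̇(t⁺) = P_{𝒞_{t,q(t)}}[q̇(t⁻)]` at every interior time, and the initial
conditions. -/
structure ImpactAndInitial (T : ℝ) (C : ℝ → Set E) (q₀ u₀ : E) (q u : ℝ → E) : Prop where
  impact : ∀ t ∈ Ioo 0 T,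
    proj (admissibleVelocities C t (q t)) (Function.leftLim u t) = {Function.rightLim u t}
  initial_pos : q 0 = q₀
  initial_vel : u 0 = u₀

/-- `q`, with velocity `u = q̇`, solves on `[0, T]`
`dq̇ + N(C(t), q) ∋ f(t, q) dt`, `q̇(t⁺) = P_{𝒞_{t,q(t)}}[q̇(t⁻)]`, `q(0) = q₀`, `q̇(0) = u₀`.
Since proximal normal cones are empty off the set, `reaction` contains `q(s) ∈ C(s)` for all `s`.
The condition `force` is needed for the measure `f(t, q(t)) dt` to make sense. -/
structure IsInclusionSolution [CompleteSpace E] [MeasurableSpace E] (T : ℝ) (C : ℝ → Set E)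
    (f : ℝ → E → E) (q₀ u₀ : E) (q u : ℝ → E) : Prop extends
    IsTrajectory T q u, ImpactAndInitial T C q₀ u₀ q u where
  force : IntegrableOn (fun t => f t (q t)) (Icc 0 T)
  reaction : ∃ (k ξ : ℝ → E) (hk : BoundedVariationOn k (Icc 0 T)),
    differentialMeasure bv + differentialMeasure hk = forceMeasure T f q ∧
    Measurable ξ ∧
    (∀ s ∈ Icc 0 T, ξ s ∈ proxNormalCone (C s) (q s)) ∧
    (∀ᵐ s ∂variationMeasure hk, ‖ξ s‖ = 1) ∧
    ∀ t ∈ Icc 0 T,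
      variationFun k t =
        ∫ s in (0 : ℝ)..t, {s | q s ∈ frontier (C s)}.indicator (fun _ => (1 : ℝ)) s
          ∂variationMeasure hk ∧
      k t = ∫ s in (0 : ℝ)..t, ξ s ∂variationMeasure hk

end Inclusion

/-! ### Moving sets defined by constraints and the Kuhn–Tucker formulation -/

section Constraints

variable {E : Type*} [NormedAddCommGroup E] [InnerProductSpace ℝ E] [CompleteSpace E] {p : ℕ}

/-- `Q(t) = {x : g_i(t, x) ≥ 0 for all i}`. -/
def feasible (g : Fin p → ℝ → E → ℝ) (t : ℝ) : Set E := {x | ∀ i, 0 ≤ g i t x}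

/-- `Ω = {(t, x) : t ∈ [0, T], x ∈ Q(t)}`. -/
def graphSet (T : ℝ) (g : Fin p → ℝ → E → ℝ) : Set (ℝ × E) :=
  {z | z.1 ∈ Icc 0 T ∧ z.2 ∈ feasible g z.1}

/-- `Ω_i = {(t, x) : t ∈ [0, T], g_i(t, x) ≥ 0}`. -/
def graphSetOf (T : ℝ) (g : Fin p → ℝ → E → ℝ) (i : Fin p) : Set (ℝ × E) :=
  {z | z.1 ∈ Icc 0 T ∧ 0 ≤ g i z.1 z.2}

/-- The part of `S + κ B` in `[0, T] × E`, where `B` is the closed Euclidean unit ball of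
`ℝ × E`. -/
def fattening (T κ : ℝ) (S : Set (ℝ × E)) : Set (ℝ × E) :=
  {z | z.1 ∈ Icc 0 T ∧ ∃ w ∈ S, (z.1 - w.1) ^ 2 + ‖z.2 - w.2‖ ^ 2 ≤ κ ^ 2}

/-- The regularity of the constraints, the uniform bounds on their derivatives and the reverse
triangle inequality for the almost active constraints. The constraints are functions on `[0, T] × E`: derivatives in time are
taken within `[0, T]` (so they are one-sided at `0` and `T`). -/
structure ConstraintAssumptions (T : ℝ) (g : Fin p → ℝ → E → ℝ) (α β M κ ρ γ : ℝ) : Prop where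
  α_pos : 0 < α
  β_pos : 0 < β
  M_pos : 0 < M
  κ_pos : 0 < κ
  ρ_pos : 0 < ρ
  γ_pos : 0 < γ
  /-- `g_i` is of class `C²` on `Ω + κ B`. -/
  contDiff : ∀ i, ∀ z ∈ fattening T κ (graphSet T g),
    ContDiffWithinAt ℝ 2 (fun y : ℝ × E => g i y.1 y.2) (Icc 0 T ×ˢ univ) z
  /-- `α ≤ |∇ₓ g_i| ≤ β` on `Ω_i + κ B`. -/
  grad_bound : ∀ i, ∀ z ∈ fattening T κ (graphSetOf T g i),
    α ≤ ‖gradient (g i z.1) z.2‖ ∧ ‖gradient (g i z.1) z.2‖ ≤ β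
  /-- `|∂ₜ g_i| ≤ β` on `Ω_i + κ B`. -/
  dt_bound : ∀ i, ∀ z ∈ fattening T κ (graphSetOf T g i),
    |derivWithin (fun s => g i s z.2) (Icc 0 T) z.1| ≤ β
  /-- `|Dₓ² g_i| ≤ M` on `Ω_i + κ B`. -/
  hess_bound : ∀ i, ∀ z ∈ fattening T κ (graphSetOf T g i),
    ‖fderiv ℝ (gradient (g i z.1)) z.2‖ ≤ M
  /-- `|∂ₜ² g_i| + |∂ₜ ∇ₓ g_i| ≤ M` on `Ω_i + κ B`. -/
  dt_two_bound : ∀ i, ∀ z ∈ fattening T κ (graphSetOf T g i),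
    |iteratedDerivWithin 2 (fun s => g i s z.2) (Icc 0 T) z.1| +
      ‖derivWithin (fun s => gradient (g i s) z.2) (Icc 0 T) z.1‖ ≤ M
  /-- `∑ λ_i |∇ₓ g_i| ≤ γ |∑ λ_i ∇ₓ g_i|`, both sums over `I_ρ(t, x) = {i : g_i(t, x) ≤ ρ}`. -/
  reverse_triangle : ∀ t ∈ Icc 0 T, ∀ x ∈ feasible g t, ∀ c : Fin p → ℝ, (∀ i, 0 ≤ c i) →
    ∑ i with g i t x ≤ ρ, c i * ‖gradient (g i t) x‖ ≤
      γ * ‖∑ i with g i t x ≤ ρ, c i • gradient (g i t) x‖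

/-- `q`, with velocity `u = q̇`, and the finite positive measures `lam i` solve on `[0, T]` the
Kuhn–Tucker problem: `q(t) ∈ Q(t)`, `dq̇ = f(t, q) dt + ∑ ∇_q g_i(t, q) dλ_i`,
`supp λ_i ⊆ {t ∈ [0, T] : g_i(t, q(t)) = 0}`, with the impact law and the initial conditions. -/
structure IsKuhnTuckerSolution [MeasurableSpace E] (T : ℝ) (g : Fin p → ℝ → E → ℝ)
    (f : ℝ → E → E) (q₀ u₀ : E) (q u : ℝ → E) (lam : Fin p → Measure ℝ) : Prop extends
    IsTrajectory T q u, ImpactAndInitial T (feasible g) q₀ u₀ q u where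
  force : IntegrableOn (fun t => f t (q t)) (Icc 0 T)
  finite : ∀ i, IsFiniteMeasure (lam i)
  mem : ∀ t ∈ Icc 0 T, q t ∈ feasible g t
  balance : differentialMeasure bv =
    forceMeasure T f q + ∑ i, (lam i).withDensityᵥ fun t => gradient (g i t) (q t)
  support : ∀ i, (lam i).support ⊆ {t | t ∈ Icc 0 T ∧ g i t (q t) = 0}

end Constraints

end SecondOrder

end

/-! The trajectory, the integrable force, the impact law and the initial data are common to both
formulations; only the reaction has to be translated.

Pointwise, the proximal normals to `Q(t)` at a feasible point are exactly the vectors `-∑ c_i ∇g_i`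
with `c_i ≥ 0` carried by the active constraints. One inclusion is a second order expansion
(`neg_sum_mem_proxNormalCone`), the other is Gordan's alternative together with positive
independence of the active gradients (`exists_eq_neg_sum_of_mem_proxNormalCone`). The inequality
`R_ρ` supplies that independence and, with `α ≤ |∇g_i|`, bounds the coefficients of a unit normal by
`γ / α` (`exists_coeff_of_mem_proxNormalCone`).

From the inclusion to multipliers: `dk = ξ d|k|`, the coefficients `a_i` of `-ξ` can be chosen
measurably (`exists_measurable_coeff`), and `λ_i = a_i d|k|` are finite because the `a_i` are
bounded.

Conversely, with `ν = ∑ λ_i` and `λ_i = a_i ν`, let `k` be the primitive of `ψ = -∑ a_i ∇g_i` with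
respect to `ν`. Then `d|k| = |ψ| ν` (`variationMeasure_eq_withDensity`), so `ξ = ψ / |ψ|` is the
polar decomposition of `dk`.

The integrals over `(0, t]` ignore the origin, so atoms at `0` must be excluded: by the formula for
`|k|(T)` in one direction, and by `q₀` being interior in the other. -/

namespace SecondOrder

/-! ### Proximal normals of a set defined by inequalities. -/

section NormalCone

variable {E : Type*} [NormedAddCommGroup E] [InnerProductSpace ℝ E]

/-- **Gordan's theorem of the alternative** for a finite family of vectors. -/
lemma exists_forall_inner_pos_or_exists_mem_stdSimplex [CompleteSpace E] {ι : Type*} [Fintype ι]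
    (w : ι → E) :
    (∃ h : E, ∀ i, 0 < inner ℝ (w i) h) ∨ ∃ c ∈ stdSimplex ℝ ι, ∑ i, c i • w i = 0 := by
  let L : (ι → ℝ) →ₗ[ℝ] E := Fintype.linearCombination ℝ w
  have hL : ∀ c, L c = ∑ i, c i • w i := fun c => Fintype.linearCombination_apply ℝ w c
  -- The image of the simplex is the convex hull of the `w i`, compact and convex; if it misses `0`,
  -- a separating functional gives `h`.
  by_cases h0 : (0 : E) ∈ L '' stdSimplex ℝ ι
  · obtain ⟨c, hc, h⟩ := h0
    exact Or.inr ⟨c, hc, by rw [← hL, h]⟩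
  · left
    have hcont : Continuous L := by
      have : (L : (ι → ℝ) → E) = fun c => ∑ i, c i • w i := funext hL
      rw [this]
      fun_prop
    obtain ⟨φ, r, hlt, hr⟩ := geometric_hahn_banach_closed_point
      ((convex_stdSimplex ℝ ι).linear_image L)
      ((isCompact_stdSimplex ℝ ι).image hcont).isClosed h0
    refine ⟨-(InnerProductSpace.toDual ℝ E).symm φ, fun i => ?_⟩
    classical
    have h := hlt (w i) ⟨Pi.single i 1, single_mem_stdSimplex ℝ i, by
      rw [hL, Finset.sum_eq_single i] <;> simp +contextual⟩
    rw [map_zero] at hr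
    rw [inner_neg_right, real_inner_comm, InnerProductSpace.toDual_symm_apply]
    linarith

/-- The variational form of proximal normality. -/
lemma inner_le_of_mem_proj {Q : Set E} {x v : E} {s : ℝ} (hs : 0 < s)
    (h : x ∈ proj Q (x + s • v)) {y : E} (hy : y ∈ Q) :
    inner ℝ v (y - x) ≤ ‖y - x‖ ^ 2 / (2 * s) := by
  have h1 : dist (x + s • v) x ≤ dist (x + s • v) y := by
    rw [h.2]
    exact Metric.infDist_le_dist_of_mem hy
  rw [dist_eq_norm, dist_eq_norm, add_sub_cancel_left] at h1
  have h2 : x + s • v - y = s • v - (y - x) := by abel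
  rw [h2] at h1
  have h3 : ‖s • v‖ ^ 2 ≤ ‖s • v - (y - x)‖ ^ 2 := by gcongr
  rw [norm_sub_sq_real, real_inner_smul_left] at h3
  rw [le_div_iff₀ (by positivity)]
  linarith

/-- Expanding `|s v - (y - x)|²` shows that the quadratic bound says that no `y ∈ Q` is closer to `x
+ s v` than `x`, when `s = 1 / (2C)`. -/
lemma mem_proxNormalCone_of_inner_le {Q : Set E} {x v : E} {C : ℝ} (hC : 0 < C) (hx : x ∈ Q)
    (h : ∀ y ∈ Q, inner ℝ v (y - x) ≤ C * ‖y - x‖ ^ 2) : v ∈ proxNormalCone Q x := by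
  refine ⟨1 / (2 * C), by positivity, hx, le_antisymm ?_ (Metric.infDist_le_dist_of_mem hx)⟩
  refine (Metric.le_infDist ⟨x, hx⟩).2 fun y hy => ?_
  have h1 := h y hy
  rw [dist_eq_norm, dist_eq_norm, add_sub_cancel_left]
  have h2 : x + (1 / (2 * C)) • v - y = (1 / (2 * C)) • v - (y - x) := by abel
  rw [h2]
  refine le_of_sq_le_sq ?_ (norm_nonneg _)
  rw [norm_sub_sq_real, real_inner_smul_left]
  have h3 : 2 * (1 / (2 * C) * inner ℝ v (y - x)) = inner ℝ v (y - x) / C := by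
    field_simp
  have h4 : inner ℝ v (y - x) / C ≤ ‖y - x‖ ^ 2 := by
    rw [div_le_iff₀ hC]
    linarith
  linarith

lemma mem_of_mem_proxNormalCone {Q : Set E} {x v : E} (h : v ∈ proxNormalCone Q x) : x ∈ Q := by
  obtain ⟨s, -, hs, -⟩ := h
  exact hs

/-- A function of class `C²` is bounded by its first order expansion up to a quadratic error. -/
lemma exists_forall_le_add_sq_of_contDiffAt {f : E → ℝ} {x : E} (hf : ContDiffAt ℝ 2 f x) :
    ∃ K > 0, ∃ δ > 0, ∀ y, ‖y - x‖ < δ →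
      f y - f x - fderiv ℝ f x (y - x) ≤ K * ‖y - x‖ ^ 2 := by
  have h1 : ContDiffAt ℝ 1 (fderiv ℝ f) x := hf.fderiv_right (by norm_num)
  obtain ⟨K, t, ht, hK⟩ := h1.exists_lipschitzOnWith
  have h2 : ∀ᶠ y in 𝓝 x, DifferentiableAt ℝ f y :=
    (hf.eventually (by simp)).mono fun y hy => hy.differentiableAt (by simp)
  obtain ⟨δ, hδ, hball⟩ := Metric.eventually_nhds_iff.1 (h2.and ht)
  -- The Lipschitz constant `K` of the derivative may be zero; the `+ 1` only makes the constant
  -- positive.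
  refine ⟨K + 1, by positivity, δ, hδ, fun y hy => ?_⟩
  have hsub : ∀ z ∈ Metric.closedBall x ‖y - x‖, dist z x < δ := fun z hz =>
    (Metric.mem_closedBall.1 hz).trans_lt hy
  have hx : x ∈ Metric.closedBall x ‖y - x‖ := by simp
  have h3 := (convex_closedBall x ‖y - x‖).norm_image_sub_le_of_norm_fderiv_le'
    (f := f) (φ := fderiv ℝ f x) (C := K * ‖y - x‖) (x := x) (y := y)
    (fun z hz => (hball (hsub z hz)).1)
    (fun z hz => by
      have := hK.norm_sub_le (hball (hsub z hz)).2 (hball (hsub x hx)).2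
      refine this.trans ?_
      gcongr
      simpa [dist_eq_norm] using hz)
    hx (by simp [dist_eq_norm])
  have h4 := (le_abs_self _).trans h3
  nlinarith [sq_nonneg ‖y - x‖]

variable [CompleteSpace E] {p : ℕ} {g : Fin p → E → ℝ} {x : E}

lemma inner_gradient_eq_fderiv {f : E → ℝ} (y : E) :
    inner ℝ (gradient f x) y = fderiv ℝ f x y := by
  rw [gradient, InnerProductSpace.toDual_symm_apply]

/-- Nonnegative combinations of the opposite gradients of active constraints are proximal
normals. -/
lemma neg_sum_mem_proxNormalCone (hx : ∀ i, 0 ≤ g i x) (hg : ∀ i, ContDiffAt ℝ 2 (g i) x)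
    {c : Fin p → ℝ} (hc : ∀ i, 0 ≤ c i) (hact : ∀ i, g i x ≠ 0 → c i = 0) :
    -∑ i, c i • gradient (g i) x ∈ proxNormalCone {y | ∀ i, 0 ≤ g i y} x := by
  choose K hK δ hδ h using fun i => exists_forall_le_add_sq_of_contDiffAt (hg i)
  obtain ⟨r, hr, hrδ⟩ : ∃ r > 0, ∀ i, r ≤ δ i := by
    rcases isEmpty_or_nonempty (Fin p) with hp | hp
    · exact ⟨1, one_pos, fun i => hp.elim i⟩
    · obtain ⟨j, hj⟩ := Finite.exists_min δ
      exact ⟨δ j, hδ j, hj⟩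
  set v := -∑ i, c i • gradient (g i) x with hv
  have hS : 0 ≤ ∑ i, c i * K i := Finset.sum_nonneg fun i _ => mul_nonneg (hc i) (hK i).le
  -- The first term serves for `|y - x| < r`, where all the expansions hold; the second serves
  -- farther away, where Cauchy–Schwarz and `|y - x| ≤ |y - x|² / r` suffice.
  refine mem_proxNormalCone_of_inner_le (C := ∑ i, c i * K i + ‖v‖ / r + 1) (by positivity) hx ?_
  intro y hy
  rcases lt_or_ge ‖y - x‖ r with hlt | hge
  · have h1 : inner ℝ v (y - x) ≤ (∑ i, c i * K i) * ‖y - x‖ ^ 2 := by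
      rw [hv, inner_neg_left, sum_inner, ← Finset.sum_neg_distrib, Finset.sum_mul]
      refine Finset.sum_le_sum fun i _ => ?_
      rw [real_inner_smul_left, inner_gradient_eq_fderiv]
      by_cases hi : g i x = 0
      · have h2 := h i y (hlt.trans_le (hrδ i))
        have h3 : 0 ≤ g i y := hy i
        have h4 : -fderiv ℝ (g i) x (y - x) ≤ K i * ‖y - x‖ ^ 2 := by linarith
        have h5 := mul_le_mul_of_nonneg_left h4 (hc i)
        linarith
      · simp [hact i hi]
    have : 0 ≤ (‖v‖ / r + 1) * ‖y - x‖ ^ 2 := by positivity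
    linarith
  · have h1 : ‖y - x‖ ≤ ‖y - x‖ ^ 2 / r := by
      rw [le_div_iff₀ hr, sq]
      gcongr
    have h2 : inner ℝ v (y - x) ≤ ‖v‖ / r * ‖y - x‖ ^ 2 := by
      calc inner ℝ v (y - x) ≤ ‖v‖ * ‖y - x‖ := real_inner_le_norm _ _
        _ ≤ ‖v‖ * (‖y - x‖ ^ 2 / r) := by gcongr
        _ = ‖v‖ / r * ‖y - x‖ ^ 2 := by ring
    have : 0 ≤ (∑ i, c i * K i + 1) * ‖y - x‖ ^ 2 := by positivity
    linarith

/-- A direction in which all active constraints increase strictly is feasible. -/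
lemma eventually_add_smul_feasible (hx : ∀ i, 0 ≤ g i x)
    (hg : ∀ i, DifferentiableAt ℝ (g i) x) {h : E}
    (hh : ∀ i, g i x = 0 → 0 < inner ℝ (gradient (g i) x) h) :
    ∀ᶠ ε in 𝓝[>] (0 : ℝ), ∀ i, 0 ≤ g i (x + ε • h) := by
  rw [eventually_all]
  intro i
  have hd : HasDerivAt (fun ε : ℝ => g i (x + ε • h)) (fderiv ℝ (g i) x h) 0 := by
    have h1 : HasDerivAt (fun ε : ℝ => x + ε • h) h 0 := by
      simpa using ((hasDerivAt_id (0 : ℝ)).smul_const h).const_add x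
    have h2 : HasFDerivAt (g i) (fderiv ℝ (g i) x) (x + (0 : ℝ) • h) := by
      simpa using (hg i).hasFDerivAt
    exact h2.comp_hasDerivAt 0 h1
  rcases (hx i).eq_or_lt with h0 | hpos
  · have hlim := hd.tendsto_slope_zero_right
    have hp := hh i h0.symm
    rw [inner_gradient_eq_fderiv] at hp
    filter_upwards [hlim.eventually (lt_mem_nhds hp), self_mem_nhdsWithin] with ε h1 h2
    simp only [zero_add, zero_smul, add_zero, ← h0, sub_zero, smul_eq_mul] at h1
    exact (pos_of_mul_pos_right h1 (inv_nonneg.2 (le_of_lt h2))).le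
  · have hc := hd.continuousAt.tendsto
    simp only [zero_smul, add_zero] at hc
    exact ((hc.eventually (lt_mem_nhds hpos)).filter_mono nhdsWithin_le_nhds).mono
      fun _ h => h.le

/-- Under positive linear independence of the active gradients, every proximal normal is a
nonnegative combination of the opposite gradients of active constraints. -/
lemma exists_eq_neg_sum_of_mem_proxNormalCone (hg : ∀ i, DifferentiableAt ℝ (g i) x)
    (hind : ∀ c : Fin p → ℝ, (∀ i, 0 ≤ c i) → (∀ i, g i x ≠ 0 → c i = 0) →
      ∑ i, c i • gradient (g i) x = 0 → c = 0)
    {v : E} (hv : v ∈ proxNormalCone {y | ∀ i, 0 ≤ g i y} x) :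
    ∃ c : Fin p → ℝ, (∀ i, 0 ≤ c i) ∧ (∀ i, g i x ≠ 0 → c i = 0) ∧
      v = -∑ i, c i • gradient (g i) x := by
  classical
  have hx : ∀ i, 0 ≤ g i x := mem_of_mem_proxNormalCone hv
  -- Gordan is applied to the active gradients together with `v` itself, indexed by `none`.
  let w : Option {i // g i x = 0} → E := fun o => o.elim v fun i => gradient (g i) x
  rcases exists_forall_inner_pos_or_exists_mem_stdSimplex w with ⟨h, hh⟩ | ⟨c, ⟨hc0, hc1⟩, hc⟩
  -- The direction `h` is feasible and has `⟨v, h⟩ > 0`, whereas proximality gives `⟨v, ε h⟩ ≤ ε²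
  -- |h|² / (2s)`; small `ε` contradicts this.
  · exfalso
    obtain ⟨s, hs, hproj⟩ := hv
    have hev := eventually_add_smul_feasible hx hg (h := h) fun i hi => hh (some ⟨i, hi⟩)
    have hvh : 0 < inner ℝ v h := hh none
    have hlim : Tendsto (fun ε : ℝ => ε * ‖h‖ ^ 2 / (2 * s)) (𝓝[>] 0) (𝓝 0) := by
      have : Continuous fun ε : ℝ => ε * ‖h‖ ^ 2 / (2 * s) := by fun_prop
      exact (this.tendsto' 0 0 (by simp)).mono_left nhdsWithin_le_nhds
    obtain ⟨ε, ⟨h1, h2⟩, h3⟩ :=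
      ((hev.and (hlim.eventually (gt_mem_nhds hvh))).and self_mem_nhdsWithin).exists
    have hε : 0 < ε := h3
    have h4 := inner_le_of_mem_proj hs hproj (y := x + ε • h) h1
    rw [add_sub_cancel_left, real_inner_smul_right, norm_smul, mul_pow, Real.norm_eq_abs,
      sq_abs] at h4
    have h5 : ε ^ 2 * ‖h‖ ^ 2 / (2 * s) = ε * (ε * ‖h‖ ^ 2 / (2 * s)) := by ring
    rw [h5] at h4
    exact absurd (le_of_mul_le_mul_left h4 hε) (not_le.2 h2)
  · let b : Fin p → ℝ := fun i => if hi : g i x = 0 then c (some ⟨i, hi⟩) else 0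
    have hb0 : ∀ i, 0 ≤ b i := fun i => by
      by_cases hi : g i x = 0
      · simp only [b, hi, dif_pos]
        exact hc0 _
      · simp [b, hi]
    have hb1 : ∀ i, g i x ≠ 0 → b i = 0 := fun i hi => by simp [b, hi]
    have hsum : ∑ i, b i • gradient (g i) x =
        ∑ i : {i // g i x = 0}, c (some i) • gradient (g i) x := by
      rw [← Finset.sum_filter_add_sum_filter_not (Finset.univ : Finset (Fin p))
        (fun i => g i x = 0), Finset.sum_eq_zero (s := Finset.univ.filter fun i => ¬ g i x = 0)
        fun i hi => by rw [hb1 i (by simpa using hi), zero_smul], add_zero,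
        Finset.sum_subtype (p := fun i => g i x = 0) _ (by simp)]
      exact Finset.sum_congr rfl fun i _ => by simp [b, i.2]
    rw [Fintype.sum_option] at hc hc1
    have hc' : c none • v + ∑ i, b i • gradient (g i) x = 0 := by
      rw [hsum]
      exact hc
    -- A zero coefficient on `v` would leave a nontrivial vanishing combination of active gradients;
    -- a positive one can be divided out.
    rcases (hc0 none).eq_or_lt with h0 | hpos
    · exfalso
      rw [← h0, zero_smul, zero_add] at hc'
      have hbz := hind b hb0 hb1 hc'
      have : ∑ i : {i // g i x = 0}, c (some i) = 0 := Finset.sum_eq_zero fun i _ => by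
        have := congrFun hbz i
        simpa [b, i.2] using this
      rw [← h0, this] at hc1
      norm_num at hc1
    · refine ⟨fun i => (c none)⁻¹ * b i, fun i => mul_nonneg (inv_nonneg.2 hpos.le) (hb0 i),
        fun i hi => by simp [hb1 i hi], ?_⟩
      simp_rw [mul_smul]
      rw [← Finset.smul_sum, ← smul_neg, ← eq_neg_of_add_eq_zero_left hc', smul_smul,
        inv_mul_cancel₀ hpos.ne', one_smul]

end NormalCone

end SecondOrder

namespace SecondOrder

/-! ### Measurable selection of zeros of Carathéodory functions. -/

section Selection

variable {S : Type*} [MeasurableSpace S] {X : Type*} [TopologicalSpace X]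
  [TopologicalSpace.PseudoMetrizableSpace X]

/-- The set of parameters at which a Carathéodory function vanishes somewhere on a compact set is
measurable. -/
lemma measurableSet_exists_mem_eq_zero {K : Set X} (hK : IsCompact K) {φ : S → X → ℝ}
    (h0 : ∀ s c, 0 ≤ φ s c) (hc : ∀ s, Continuous (φ s)) (hm : ∀ c, Measurable fun s => φ s c) :
    MeasurableSet {s | ∃ c ∈ K, φ s c = 0} := by
  let _ := TopologicalSpace.pseudoMetrizableSpacePseudoMetric X
  obtain ⟨D, hDK, hD, hKD⟩ := hK.isSeparable.exists_countable_dense_subset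
  -- By compactness a zero exists as soon as the infimum is zero, and continuity lets a countable
  -- dense subset detect the infimum.
  have h : {s | ∃ c ∈ K, φ s c = 0} = ⋂ n : ℕ, ⋃ d ∈ D, {s | φ s d < 1 / ((n : ℝ) + 1)} := by
    ext s
    simp only [mem_ofPred_eq, mem_iInter, mem_iUnion, exists_prop]
    constructor
    · rintro ⟨c, hcK, hcz⟩ n
      have hU : {d | φ s d < 1 / ((n : ℝ) + 1)} ∈ 𝓝 c := by
        refine (hc s).continuousAt.eventually (gt_mem_nhds ?_)
        rw [hcz]
        positivity
      obtain ⟨d, hd, hdD⟩ := mem_closure_iff_nhds.1 (hKD hcK) _ hU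
      exact ⟨d, hdD, hd⟩
    · intro h
      obtain ⟨d, hd, -⟩ := h 0
      obtain ⟨c, hcK, hmin⟩ := hK.exists_isMinOn ⟨d, hDK hd⟩ (hc s).continuousOn
      refine ⟨c, hcK, le_antisymm (ge_of_tendsto' tendsto_one_div_add_atTop_nhds_zero_nat
        fun n => ?_) (h0 s c)⟩
      obtain ⟨d, hd, hlt⟩ := h n
      exact (hmin (hDK hd)).trans hlt.le
  rw [h]
  exact MeasurableSet.iInter fun n => MeasurableSet.biUnion hD fun d _ =>
    measurableSet_lt (hm d) measurable_const

/-- The minimum of a continuous function over the zeros of a Carathéodory function in a compact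
set is a measurable function of the parameter. -/
lemma exists_measurable_eq_of_exists_eq_zero [T2Space X] {K : Set X} (hK : IsCompact K)
    {φ : S → X → ℝ}
    (h0 : ∀ s c, 0 ≤ φ s c) (hc : ∀ s, Continuous (φ s)) (hm : ∀ c, Measurable fun s => φ s c)
    (hz : ∀ s, ∃ c ∈ K, φ s c = 0) {π : X → ℝ} (hπ : Continuous π) :
    ∃ a : S → ℝ, Measurable a ∧ ∀ s, ∃ c ∈ K, φ s c = 0 ∧ π c = a s := by
  have hmin : ∀ s, ∃ c, (c ∈ K ∧ φ s c = 0) ∧ ∀ d ∈ K, φ s d = 0 → π c ≤ π d := fun s => by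
    have hKs : IsCompact (K ∩ {c | φ s c = 0}) :=
      hK.inter_right (isClosed_eq (hc s) continuous_const)
    obtain ⟨c, hc1, hc2⟩ := hKs.exists_isMinOn (hz s) hπ.continuousOn
    exact ⟨c, hc1, fun d h1 h2 => hc2 ⟨h1, h2⟩⟩
  choose c hcz hcm using hmin
  refine ⟨fun s => π (c s), measurable_of_Iic fun r => ?_, fun s => ⟨c s, (hcz s).1, (hcz s).2, rfl⟩⟩
  -- The minimum is at most `r` exactly when there is a zero in the smaller compact set `K ∩ {π ≤
  -- r}`.
  have h : (fun s => π (c s)) ⁻¹' Iic r = {s | ∃ d ∈ K ∩ {d | π d ≤ r}, φ s d = 0} := by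
    ext s
    constructor
    · intro h
      exact ⟨c s, ⟨(hcz s).1, h⟩, (hcz s).2⟩
    · rintro ⟨d, ⟨hd, hdr⟩, hdz⟩
      exact (hcm s d hd hdz).trans hdr
  rw [h]
  exact measurableSet_exists_mem_eq_zero
    (hK.inter_right (isClosed_le hπ continuous_const)) h0 hc hm

/-- A measurable selection of the zeros of a Carathéodory function in a compact set. -/
lemma exists_measurable_forall_mem_eq_zero {ι : Type*} [Fintype ι] {K : Set (ι → ℝ)}
    (hK : IsCompact K) {φ : S → (ι → ℝ) → ℝ}
    (h0 : ∀ s c, 0 ≤ φ s c) (hc : ∀ s, Continuous (φ s)) (hm : ∀ c, Measurable fun s => φ s c)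
    (hz : ∀ s, ∃ c ∈ K, φ s c = 0) :
    ∃ a : S → ι → ℝ, Measurable a ∧ ∀ s, a s ∈ K ∧ φ s (a s) = 0 := by
  classical
  -- Coordinates are fixed one at a time: each is minimized among the zeros that agree with the
  -- previous choices, an agreement imposed by adding `∑ |c i - a i s|` to `φ`.
  have key : ∀ F : Finset ι, ∃ a : ι → S → ℝ, (∀ i, Measurable (a i)) ∧
      ∀ s, ∃ c ∈ K, φ s c = 0 ∧ ∀ i ∈ F, c i = a i s := by
    intro F
    induction F using Finset.induction_on with
    | empty => exact ⟨0, fun _ => measurable_const, fun s => by simpa using hz s⟩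
    | insert j F hj ih =>
      obtain ⟨a, ha, h⟩ := ih
      obtain ⟨b, hb, h'⟩ := exists_measurable_eq_of_exists_eq_zero hK
        (φ := fun s c => φ s c + ∑ i ∈ F, |c i - a i s|)
        (fun s c => add_nonneg (h0 s c) (Finset.sum_nonneg fun _ _ => abs_nonneg _))
        (fun s => by
          have := hc s
          fun_prop)
        (fun c => (hm c).add (Finset.measurable_fun_sum F fun i _ => by
          have := ha i
          fun_prop))
        (fun s => by
          obtain ⟨c, hcK, hcz, hca⟩ := h s
          exact ⟨c, hcK, by simp +contextual [hcz, hca]⟩)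
        (continuous_apply j)
      refine ⟨Function.update a j b, fun i => ?_, fun s => ?_⟩
      · rcases eq_or_ne i j with rfl | hij
        · simpa using hb
        · simpa [hij] using ha i
      · obtain ⟨c, hcK, hcz, hcb⟩ := h' s
        have hs : 0 ≤ ∑ i ∈ F, |c i - a i s| := Finset.sum_nonneg fun _ _ => abs_nonneg _
        have hs0 : ∑ i ∈ F, |c i - a i s| = 0 := by linarith [h0 s c]
        refine ⟨c, hcK, by linarith [h0 s c], fun i hi => ?_⟩
        rcases eq_or_ne i j with rfl | hij
        · simpa using hcb
        · have hiF := Finset.mem_of_mem_insert_of_ne hi hij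
          have := (Finset.sum_eq_zero_iff_of_nonneg fun _ _ => abs_nonneg _).1 hs0 i hiF
          simpa [hij] using sub_eq_zero.1 (abs_eq_zero.1 this)
  obtain ⟨a, ha, h⟩ := key Finset.univ
  refine ⟨fun s i => a i s, measurable_pi_lambda _ ha, fun s => ?_⟩
  obtain ⟨c, hcK, hcz, hca⟩ := h s
  have : c = fun i => a i s := funext fun i => hca i (Finset.mem_univ i)
  rw [this] at hcK hcz
  exact ⟨hcK, hcz⟩

/-- Measurable choice of the coefficients of a bounded nonnegative combination. -/
lemma exists_measurable_coeff {E : Type*} [NormedAddCommGroup E] [NormedSpace ℝ E]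
    [MeasurableSpace E] [BorelSpace E] [SecondCountableTopology E] {ι : Type*} [Fintype ι]
    {G : ι → S → E} (hG : ∀ i, Measurable (G i)) {η : S → E} (hη : Measurable η)
    {A : ι → Set S} (hA : ∀ i, MeasurableSet (A i)) {C : ℝ}
    (h : ∀ s, ∃ c : ι → ℝ, (∀ i, 0 ≤ c i) ∧ (∀ i, c i ≤ C) ∧ (∀ i, s ∉ A i → c i = 0) ∧
      η s = ∑ i, c i • G i s) :
    ∃ a : ι → S → ℝ, (∀ i, Measurable (a i)) ∧ (∀ i s, 0 ≤ a i s) ∧ (∀ i s, a i s ≤ C) ∧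
      (∀ i, ∀ s ∉ A i, a i s = 0) ∧ ∀ s, η s = ∑ i, a i s • G i s := by
  classical
  have hsum : ∀ s (c : ι → ℝ), 0 ≤ ∑ i, (A i)ᶜ.indicator (fun _ => (1 : ℝ)) s * |c i| :=
    fun s c => Finset.sum_nonneg fun i _ =>
      mul_nonneg (indicator_nonneg (fun _ _ => zero_le_one) s) (abs_nonneg _)
  obtain ⟨a, ha, h'⟩ := exists_measurable_forall_mem_eq_zero
    (isCompact_univ_pi fun _ : ι => isCompact_Icc (a := (0 : ℝ)) (b := C))
    -- The zeros of this function encode both the representation of `η s` and the vanishing of `c i`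
    -- off `A i`.
    (φ := fun s c => ‖η s - ∑ i, c i • G i s‖ +
      ∑ i, (A i)ᶜ.indicator (fun _ => (1 : ℝ)) s * |c i|)
    (fun s c => add_nonneg (norm_nonneg _) (hsum s c))
    (fun s => by fun_prop)
    (fun c => by
      refine (Measurable.norm (hη.sub (Finset.measurable_fun_sum _ fun i _ =>
        (hG i).const_smul (c i)))).add (Finset.measurable_fun_sum _ fun i _ =>
        (measurable_const.indicator (hA i).compl).mul_const _))
    (fun s => by
      obtain ⟨c, h1, h2, h3, h4⟩ := h s
      refine ⟨c, fun i _ => ⟨h1 i, h2 i⟩, ?_⟩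
      rw [← h4, sub_self, norm_zero, zero_add]
      refine Finset.sum_eq_zero fun i _ => ?_
      by_cases hi : s ∈ A i
      · simp [hi]
      · simp [h3 i hi])
  refine ⟨fun i s => a s i, fun i => (measurable_pi_apply i).comp ha,
    fun i s => ((h' s).1 i (mem_univ i)).1, fun i s => ((h' s).1 i (mem_univ i)).2, ?_, ?_⟩
  · intro i s hi
    have h1 := (h' s).2
    have h2 : ∑ i, (A i)ᶜ.indicator (fun _ => (1 : ℝ)) s * |a s i| = 0 :=
      le_antisymm (by linarith [norm_nonneg (η s - ∑ i, a s i • G i s)]) (hsum s _)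
    have h3 := (Finset.sum_eq_zero_iff_of_nonneg fun i _ =>
      mul_nonneg (indicator_nonneg (fun _ _ => zero_le_one) s) (abs_nonneg _)).1 h2 i
      (Finset.mem_univ i)
    simpa [hi] using h3
  · intro s
    have h1 := (h' s).2
    have h2 : ‖η s - ∑ i, a s i • G i s‖ = 0 :=
      le_antisymm (by linarith [hsum s (a s)]) (norm_nonneg _)
    exact sub_eq_zero.1 (norm_eq_zero.1 h2)

end Selection

end SecondOrder

namespace SecondOrder

/-! ### Differential and variation measures of primitives. -/

section Primitive

variable {E : Type*} [NormedAddCommGroup E]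

lemma variationFun_zero (k : ℝ → E) : variationFun k 0 = 0 := by
  simp [variationFun]

lemma clamp_of_le_zero {T t : ℝ} (ht : t ≤ 0) : clamp T t = 0 :=
  max_eq_left ((min_le_left _ _).trans ht)

lemma clamp_of_ge {T t : ℝ} (hT : 0 ≤ T) (ht : T ≤ t) : clamp T t = T := by
  rw [clamp, min_eq_right ht, max_eq_right hT]

lemma clamp_of_mem {T t : ℝ} (ht : t ∈ Icc 0 T) : clamp T t = t := by
  rw [clamp, min_eq_left ht.2, max_eq_right ht.1]

lemma borel_eq_generateFrom_Ioc_real :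
    (inferInstance : MeasurableSpace ℝ) =
      MeasurableSpace.generateFrom {s | ∃ u v : ℝ, u ≤ v ∧ s = Ioc u v} := by
  borelize ℝ
  convert! borel_eq_generateFrom_Ioc_le ℝ using 2
  grind only

/-- Vector measures on the line are determined by their values on half-open intervals. -/
lemma vectorMeasure_ext_of_Ioc {μ ν : VectorMeasure ℝ E}
    (h : ∀ a b, a ≤ b → μ (Ioc a b) = ν (Ioc a b)) : μ = ν := by
  refine VectorMeasure.ext_of_generateFrom {s | ∃ u v : ℝ, u ≤ v ∧ s = Ioc u v} ?_
    borel_eq_generateFrom_Ioc_real IsSetSemiring.Ioc.isPiSystem ?_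
  · rintro _ ⟨u, v, huv, rfl⟩
    exact h u v huv
  · have hU : (univ : Set ℝ) = ⋃ n : ℕ, Ioc (-(n : ℝ)) n := by
      symm
      rw [eq_univ_iff_forall]
      intro x
      obtain ⟨n, hn⟩ := exists_nat_gt |x|
      exact mem_iUnion.2 ⟨n, (abs_lt.1 hn).1, (abs_lt.1 hn).2.le⟩
    have hmono : Monotone fun n : ℕ => Ioc (-(n : ℝ)) n := fun m n hmn =>
      Ioc_subset_Ioc (neg_le_neg (by exact_mod_cast hmn)) (by exact_mod_cast hmn)
    have h1 := μ.tendsto_vectorMeasure_iUnion_atTop_nat hmono fun n => measurableSet_Ioc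
    have h2 := ν.tendsto_vectorMeasure_iUnion_atTop_nat hmono fun n => measurableSet_Ioc
    rw [← hU] at h1 h2
    refine tendsto_nhds_unique h1 (h2.congr fun n => (h _ _ ?_).symm)
    have : (0 : ℝ) ≤ n := n.cast_nonneg
    linarith

lemma tendsto_measure_Ioc_nhdsGT (m : Measure ℝ) [IsFiniteMeasure m] (a : ℝ) :
    Tendsto (fun b => m (Ioc a b)) (𝓝[>] a) (𝓝 0) := by
  have h : ⋂ b > a, Ioc a b = (∅ : Set ℝ) := by
    ext x
    simp only [mem_iInter, mem_Ioc, mem_empty_iff_false, iff_false, not_forall]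
    by_cases hx : a < x
    · obtain ⟨y, hy⟩ := exists_between hx
      exact ⟨y, hy.1, fun h => absurd h.2 (not_le.2 hy.2)⟩
    · exact ⟨a + 1, by simp, fun h => hx h.1⟩
  rw [← measure_empty (μ := m), ← h]
  exact tendsto_measure_biInter_gt (fun _ _ => measurableSet_Ioc.nullMeasurableSet)
    (fun i j _ hij => Ioc_subset_Ioc_right hij) ⟨a + 1, by simp, measure_ne_top _ _⟩

/-- A function whose increments are dominated by a finite measure is right continuous. -/
lemma continuousWithinAt_Ioi_of_enorm_sub_le {W : ℝ → E}
    {m : Measure ℝ} [IsFiniteMeasure m] {a : ℝ}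
    (h : ∀ b > a, ‖W b - W a‖ₑ ≤ m (Ioc a b)) : ContinuousWithinAt W (Ioi a) a := by
  rw [ContinuousWithinAt, tendsto_iff_edist_tendsto_0]
  refine tendsto_of_tendsto_of_tendsto_of_le_of_le' tendsto_const_nhds
    (tendsto_measure_Ioc_nhdsGT m a) (Eventually.of_forall fun _ => zero_le) ?_
  filter_upwards [self_mem_nhdsWithin] with b hb
  rw [edist_eq_enorm_sub]
  exact h b hb

lemma rightLim_eq_of_enorm_sub_le {W : ℝ → E}
    {m : Measure ℝ} [IsFiniteMeasure m] {a : ℝ}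
    (h : ∀ b > a, ‖W b - W a‖ₑ ≤ m (Ioc a b)) : Function.rightLim W a = W a :=
  rightLim_eq_of_tendsto (continuousWithinAt_Ioi_of_enorm_sub_le h)

lemma isFiniteMeasure_withDensity_enorm {μ : Measure ℝ} {ψ : ℝ → E} (hψ : Integrable ψ μ) :
    IsFiniteMeasure (μ.withDensity fun x => ‖ψ x‖ₑ) :=
  ⟨by simpa using! hψ.2⟩

/-- The half-open intervals between consecutive points of a partition are disjoint, so their masses
add up to at most that of `(a, b]`. -/
lemma eVariationOn_Icc_le_of_edist_le {F : ℝ → E} {m : Measure ℝ}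
    (h : ∀ a b, a ≤ b → edist (F b) (F a) ≤ m (Ioc a b)) (a b : ℝ) :
    eVariationOn F (Icc a b) ≤ m (Ioc a b) := by
  refine iSup_le fun P => ?_
  obtain ⟨n, u, hu, hmem⟩ := P
  calc ∑ i ∈ Finset.range n, edist (F (u (i + 1))) (F (u i))
      ≤ ∑ i ∈ Finset.range n, m (Ioc (u i) (u (i + 1))) :=
        Finset.sum_le_sum fun i _ => h _ _ (hu i.le_succ)
    _ = m (⋃ i ∈ Finset.range n, Ioc (u i) (u (i + 1))) :=
        (measure_biUnion_finset
          (fun i _ j _ hij => hu.pairwise_disjoint_on_Ioc_succ hij)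
          fun _ _ => measurableSet_Ioc).symm
    _ ≤ m (Ioc a b) := measure_mono <| iUnion₂_subset fun i _ =>
        Ioc_subset_Ioc (hmem i).1 (hmem (i + 1)).2

lemma variationFun_sub {k : ℝ → E} {T : ℝ} (hk : BoundedVariationOn k (Icc 0 T)) {a b : ℝ}
    (ha : 0 ≤ a) (hab : a ≤ b) (hb : b ≤ T) :
    variationFun k b - variationFun k a = (eVariationOn k (Icc a b)).toReal := by
  have h := eVariationOn.Icc_add_Icc k (s := univ) ha hab (mem_univ a)
  simp only [univ_inter] at h
  rw [variationFun, variationFun, ← h, ENNReal.toReal_add, add_sub_cancel_left]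
  · exact hk.mono (Icc_subset_Icc_right (hab.trans hb))
  · exact hk.mono (Icc_subset_Icc ha hb)

instance isFiniteMeasure_variationMeasure {T : ℝ} {k : ℝ → E}
    (hk : BoundedVariationOn k (Icc 0 T)) : IsFiniteMeasure (variationMeasure hk) := by
  have hmono := monotone_variationFun_clamp hk
  refine StieltjesFunction.isFiniteMeasure_of_forall_abs_le
    (C := (eVariationOn k (Icc 0 (max 0 T))).toReal) _ fun x => ?_
  have hfin : eVariationOn k (Icc 0 (max 0 T)) ≠ ⊤ := by
    rcases le_total 0 T with hT | hT
    · rwa [max_eq_right hT]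
    · rw [max_eq_left hT, Icc_self]
      simp
  have hle : ∀ y, (variationFun k ∘ clamp T) y ≤ (eVariationOn k (Icc 0 (max 0 T))).toReal :=
    fun y => ENNReal.toReal_mono hfin
      (eVariationOn.mono k (Icc_subset_Icc_right (max_le_max le_rfl (min_le_right _ _))))
  rw [hmono.stieltjesFunction_eq, abs_of_nonneg]
  · exact (hmono.rightLim_le (lt_add_one x)).trans (hle _)
  · exact le_trans (ENNReal.toReal_nonneg) (hmono.le_rightLim (le_refl x))

lemma rightLim_variationFun_clamp_of_ge {T : ℝ} (hT : 0 ≤ T) (k : ℝ → E) {t : ℝ} (ht : T ≤ t) :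
    Function.rightLim (variationFun k ∘ clamp T) t = variationFun k T := by
  refine rightLim_eq_of_tendsto ?_
  refine tendsto_const_nhds.congr' ?_
  filter_upwards [self_mem_nhdsWithin] with s hs
  simp [clamp_of_ge hT (ht.trans (le_of_lt hs))]

lemma variationMeasure_compl_Icc {T : ℝ} (hT : 0 ≤ T) {k : ℝ → E}
    (hk : BoundedVariationOn k (Icc 0 T)) : variationMeasure hk (Icc 0 T)ᶜ = 0 := by
  have hmono := monotone_variationFun_clamp hk
  have h1 : variationMeasure hk (Iio 0) = 0 := by
    have : Iio (0 : ℝ) = ⋃ n : ℕ, Ioo (-(n : ℝ)) 0 := by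
      ext x
      simp only [mem_Iio, mem_iUnion, mem_Ioo]
      refine ⟨fun hx => ?_, fun ⟨_, h⟩ => h.2⟩
      obtain ⟨n, hn⟩ := exists_nat_gt (-x)
      exact ⟨n, by linarith, hx⟩
    rw [this, measure_iUnion_null_iff]
    intro n
    rw [variationMeasure, StieltjesFunction.measure_Ioo, ENNReal.ofReal_eq_zero, sub_nonpos]
    have h0 : 0 ≤ hmono.stieltjesFunction (-(n : ℝ)) := by
      rw [hmono.stieltjesFunction_eq]
      exact le_trans ENNReal.toReal_nonneg (hmono.le_rightLim le_rfl)
    refine le_trans ?_ h0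
    refine le_of_tendsto (hmono.stieltjesFunction.mono.tendsto_leftLim 0) ?_
    filter_upwards [self_mem_nhdsWithin] with s hs
    obtain ⟨r, hsr, hr⟩ := exists_between (show s < 0 from hs)
    rw [hmono.stieltjesFunction_eq]
    refine (hmono.rightLim_le hsr).trans ?_
    simp [clamp_of_le_zero hr.le, variationFun_zero]
  have h2 : variationMeasure hk (Ioi T) = 0 := by
    have : Ioi T = ⋃ n : ℕ, Ioc T (T + n) := by
      ext x
      simp only [mem_Ioi, mem_iUnion, mem_Ioc]
      refine ⟨fun hx => ?_, fun ⟨_, h⟩ => h.1⟩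
      obtain ⟨n, hn⟩ := exists_nat_gt (x - T)
      exact ⟨n, hx, by linarith⟩
    rw [this, measure_iUnion_null_iff]
    intro n
    rw [variationMeasure, StieltjesFunction.measure_Ioc, hmono.stieltjesFunction_eq,
      hmono.stieltjesFunction_eq, rightLim_variationFun_clamp_of_ge hT k le_rfl,
      rightLim_variationFun_clamp_of_ge hT k (by simp), sub_self, ENNReal.ofReal_zero]
  refine measure_mono_null (fun x hx => ?_) (measure_union_null h1 h2)
  rw [mem_compl_iff, mem_Icc, not_and_or, not_le, not_le] at hx
  exact hx

/-- If the variation does not exceed the mass of `(0, T]`, the variation measure has no atom at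
the origin. -/
lemma variationMeasure_compl_Ioc {T : ℝ} (hT : 0 ≤ T) {k : ℝ → E}
    (hk : BoundedVariationOn k (Icc 0 T))
    (h : variationFun k T ≤ (variationMeasure hk (Ioc 0 T)).toReal) :
    variationMeasure hk (Ioc 0 T)ᶜ = 0 := by
  have hmono := monotone_variationFun_clamp hk
  have h0 : variationMeasure hk {0} = 0 := by
    -- The mass of `(0, T]` is `|k|(T) - |k|(0⁺)`, so the hypothesis forces `|k|(0⁺) ≤ 0`.
    have hle : hmono.stieltjesFunction 0 ≤ 0 := by
      rw [variationMeasure, StieltjesFunction.measure_Ioc,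
        ENNReal.toReal_ofReal (sub_nonneg.2 (hmono.stieltjesFunction.mono hT)),
        hmono.stieltjesFunction_eq T, rightLim_variationFun_clamp_of_ge hT k le_rfl] at h
      linarith
    rw [variationMeasure, StieltjesFunction.measure_singleton, ENNReal.ofReal_eq_zero, sub_nonpos]
    refine hle.trans (ge_of_tendsto (hmono.stieltjesFunction.mono.tendsto_leftLim 0)
      (Eventually.of_forall fun s => ?_))
    rw [hmono.stieltjesFunction_eq]
    exact le_trans ENNReal.toReal_nonneg (hmono.le_rightLim le_rfl)
  refine measure_mono_null (fun x hx => ?_)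
    (measure_union_null (variationMeasure_compl_Icc hT hk) h0)
  by_cases hx0 : x = 0
  · exact Or.inr hx0
  · left
    intro h
    exact hx ⟨lt_of_le_of_ne h.1 (Ne.symm hx0), h.2⟩

/-- The variation of a vector measure is dominated by every finite measure dominating it on
half-open intervals. -/
lemma variation_le_of_forall_Ioc [CompleteSpace E] {v : VectorMeasure ℝ E} {m : Measure ℝ}
    [IsFiniteMeasure m] {F : ℝ → E} (hv : ∀ a b, a ≤ b → v (Ioc a b) = F b - F a)
    (h : ∀ a b, a ≤ b → ‖v (Ioc a b)‖ₑ ≤ m (Ioc a b)) : v.variation ≤ m := by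
  -- The increments of `F` extend to a vector measure bounded by `m` on every measurable set;
  -- agreement on half-open intervals identifies it with `v`.
  obtain ⟨v', hv', hle⟩ :=
    VectorMeasure.exists_extension_of_isSetSemiring_of_le_measure_of_generateFrom (μ := m)
      (m := AddContent.onIoc F) IsSetSemiring.Ioc
      (by
        rintro _ ⟨a, b, hab, rfl⟩
        rw [AddContent.onIoc_apply hab, ← hv a b hab]
        exact h a b hab)
      borel_eq_generateFrom_Ioc_real
  have : v' = v := vectorMeasure_ext_of_Ioc fun a b hab => by
    rw [hv' _ ⟨a, b, hab, rfl⟩, AddContent.onIoc_apply hab, hv a b hab]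
  exact this ▸ VectorMeasure.variation_le_of_forall_enorm_le fun s _ => hle s

variable [NormedSpace ℝ E]

lemma integral_Iic_sub_integral_Iic {μ : Measure ℝ} {ψ : ℝ → E} (hψ : Integrable ψ μ) {a b : ℝ}
    (hab : a ≤ b) :
    ∫ s in Iic b, ψ s ∂μ - ∫ s in Iic a, ψ s ∂μ = ∫ s in Ioc a b, ψ s ∂μ := by
  rw [← Iic_union_Ioc_eq_Iic hab, setIntegral_union (Iic_disjoint_Ioc le_rfl) measurableSet_Ioc
    hψ.integrableOn hψ.integrableOn, add_sub_cancel_left]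

lemma enorm_setIntegral_le_withDensity {μ : Measure ℝ} {ψ : ℝ → E} {s : Set ℝ}
    (hs : MeasurableSet s) :
    ‖∫ x in s, ψ x ∂μ‖ₑ ≤ μ.withDensity (fun x => ‖ψ x‖ₑ) s := by
  rw [withDensity_apply _ hs]
  exact enorm_integral_le_lintegral_enorm _

/-- The vector measure of a primitive is the measure with the corresponding density. -/
lemma vectorMeasure_eq_withDensity [CompleteSpace E] {μ : Measure ℝ} {ψ : ℝ → E}
    (hψ : Integrable ψ μ) {F : ℝ → E} (hF : ∀ t, F t = ∫ s in Iic t, ψ s ∂μ)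
    (hbv : BoundedVariationOn F univ) : hbv.vectorMeasure = μ.withDensityᵥ ψ := by
  have := isFiniteMeasure_withDensity_enorm hψ
  have hr : ∀ a, Function.rightLim F a = F a := fun a =>
    rightLim_eq_of_enorm_sub_le (m := μ.withDensity fun x => ‖ψ x‖ₑ) fun b hb => by
      rw [hF, hF, integral_Iic_sub_integral_Iic hψ (le_of_lt hb)]
      exact enorm_setIntegral_le_withDensity measurableSet_Ioc
  refine vectorMeasure_ext_of_Ioc fun a b hab => ?_
  rw [hbv.vectorMeasure_Ioc hab, hr, hr, hF, hF, integral_Iic_sub_integral_Iic hψ hab,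
    withDensityᵥ_apply hψ measurableSet_Ioc]

/-- For a primitive with respect to a finite measure carried by `(0, T]`, clamping has no
effect. -/
lemma comp_clamp_eq_integral_Iic {T : ℝ} (hT : 0 ≤ T) {μ : Measure ℝ} (hμ : μ (Ioc 0 T)ᶜ = 0)
    {ψ k : ℝ → E} (hk : ∀ t ∈ Icc 0 T, k t = ∫ s in Ioc 0 t, ψ s ∂μ) (t : ℝ) :
    (k ∘ clamp T) t = ∫ s in Iic t, ψ s ∂μ := by
  rw [Function.comp_apply, hk _ (clamp_mem hT t)]
  refine setIntegral_congr_set ?_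
  have : ∀ᵐ s ∂μ, s ∈ Ioc 0 T := hμ
  filter_upwards [this] with s hs
  refine propext ⟨fun h => ?_, fun h => ⟨hs.1, ?_⟩⟩
  · rcases le_total t T with htT | htT
    · rcases le_total t 0 with ht | ht
      · have := h.2
        rw [clamp_of_le_zero ht] at this
        exact absurd hs.1 (not_lt.2 this)
      · have := h.2
        rwa [clamp_of_mem ⟨ht, htT⟩] at this
    · exact hs.2.trans htT
  · exact (le_min h hs.2).trans (le_max_right _ _)

lemma differentialMeasure_eq_withDensity [CompleteSpace E] {T : ℝ} (hT : 0 ≤ T) {μ : Measure ℝ}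
    (hμ : μ (Ioc 0 T)ᶜ = 0) {ψ k : ℝ → E} (hψ : Integrable ψ μ)
    (hk : ∀ t ∈ Icc 0 T, k t = ∫ s in Ioc 0 t, ψ s ∂μ) (hbv : BoundedVariationOn k (Icc 0 T)) :
    differentialMeasure hbv = μ.withDensityᵥ ψ :=
  vectorMeasure_eq_withDensity hψ (comp_clamp_eq_integral_Iic hT hμ hk) _

lemma edist_integral_Iic_le {μ : Measure ℝ} {ψ : ℝ → E} (hψ : Integrable ψ μ) {a b : ℝ}
    (hab : a ≤ b) : edist (∫ s in Iic b, ψ s ∂μ) (∫ s in Iic a, ψ s ∂μ) ≤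
      μ.withDensity (fun x => ‖ψ x‖ₑ) (Ioc a b) := by
  rw [edist_eq_enorm_sub, integral_Iic_sub_integral_Iic hψ hab]
  exact enorm_setIntegral_le_withDensity measurableSet_Ioc

lemma boundedVariationOn_integral_Iic {μ : Measure ℝ} {ψ : ℝ → E} (hψ : Integrable ψ μ)
    (a b : ℝ) : BoundedVariationOn (fun t => ∫ s in Iic t, ψ s ∂μ) (Icc a b) := by
  have := isFiniteMeasure_withDensity_enorm hψ
  exact ne_top_of_le_ne_top (measure_ne_top _ _)
    (eVariationOn_Icc_le_of_edist_le (fun a b hab => edist_integral_Iic_le hψ hab) a b)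

/-- The variation measure of a primitive has the norm of the derivative as its density. -/
lemma variationMeasure_eq_withDensity [CompleteSpace E] {T : ℝ} (hT : 0 ≤ T) {μ : Measure ℝ}
    (hμ : μ (Ioc 0 T)ᶜ = 0) {ψ : ℝ → E} (hψ : Integrable ψ μ)
    (hk : BoundedVariationOn (fun t => ∫ s in Iic t, ψ s ∂μ) (Icc 0 T)) :
    variationMeasure hk = μ.withDensity (fun x => ‖ψ x‖ₑ) ∧
      ∀ t ∈ Icc 0 T, variationFun (fun t => ∫ s in Iic t, ψ s ∂μ) t =
        (μ.withDensity (fun x => ‖ψ x‖ₑ) (Ioc 0 t)).toReal := by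
  set F : ℝ → E := fun t => ∫ s in Iic t, ψ s ∂μ with hF
  set m : Measure ℝ := μ.withDensity fun x => ‖ψ x‖ₑ with hm
  have hmfin : IsFiniteMeasure m := isFiniteMeasure_withDensity_enorm hψ
  have hmono := monotone_variationFun_clamp hk
  set W : ℝ → ℝ := variationFun F ∘ clamp T with hW
  have hFm : ∀ a b, a ≤ b → edist (F b) (F a) ≤ m (Ioc a b) := fun a b hab =>
    edist_integral_Iic_le hψ hab
  have hm0 : m (Ioc 0 T)ᶜ = 0 := withDensity_absolutelyContinuous _ _ hμ
  have hWsub : ∀ a b, a ≤ b →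
      W b - W a = (eVariationOn F (Icc (clamp T a) (clamp T b))).toReal := fun a b hab =>
    variationFun_sub hk (clamp_mem hT a).1 (clamp_monotone T hab) (clamp_mem hT b).2
  -- Only the part of the clamped interval inside `(0, T]` carries mass, and that part lies in `(a,
  -- b]`.
  have hvarle : ∀ a b, eVariationOn F (Icc (clamp T a) (clamp T b)) ≤ m (Ioc a b) := fun a b => by
    refine (eVariationOn_Icc_le_of_edist_le hFm _ _).trans ?_
    rw [← measure_inter_add_sdiff (Ioc (clamp T a) (clamp T b)) (measurableSet_Ioc (a := 0) (b := T)),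
      measure_mono_null (s := _ \ _) (fun x hx => hx.2) hm0, add_zero]
    refine measure_mono fun x hx => ?_
    obtain ⟨⟨h1, h2⟩, h3, h4⟩ := hx
    refine ⟨?_, ?_⟩
    · by_contra hxa
      exact absurd h1 (not_lt.2 ((le_min (not_lt.1 hxa) h4).trans (le_max_right _ _)))
    · rcases le_max_iff.1 h2 with h | h
      · exact absurd h3 (not_lt.2 h)
      · exact h.trans (min_le_left _ _)
  have hWle : ∀ a b, a ≤ b → ENNReal.ofReal (W b - W a) ≤ m (Ioc a b) := fun a b hab => by
    rw [hWsub a b hab]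
    exact ENNReal.ofReal_toReal_le.trans (hvarle a b)
  have hWr : ∀ a, Function.rightLim W a = W a := fun a =>
    rightLim_eq_of_enorm_sub_le (m := m) fun b hb => by
      rw [Real.enorm_of_nonneg (sub_nonneg.2 (hmono (le_of_lt hb)))]
      exact hWle a b (le_of_lt hb)
  have hvm : ∀ a b, variationMeasure hk (Ioc a b) = ENNReal.ofReal (W b - W a) := fun a b => by
    rw [variationMeasure, StieltjesFunction.measure_Ioc, hmono.stieltjesFunction_eq,
      hmono.stieltjesFunction_eq, hWr, hWr]
  have hFclamp : ∀ t, F (clamp T t) = F t := fun t =>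
    comp_clamp_eq_integral_Iic (k := F) hT hμ (fun t _ => by
      refine setIntegral_congr_set ?_
      have : ∀ᵐ s ∂μ, s ∈ Ioc 0 T := hμ
      filter_upwards [this] with s hs
      exact propext ⟨fun h => ⟨hs.1, h⟩, fun h => h.2⟩) t
  -- `m` is the variation of the vector measure `ψ μ`, whose value on `(a, b]` is an increment of
  -- `F` and hence bounded by the variation of `F` there.
  have hle : m ≤ variationMeasure hk := by
    rw [hm, ← Measure.variation_withDensityᵥ hψ]
    refine variation_le_of_forall_Ioc (F := F) (fun a b hab => ?_) fun a b hab => ?_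
    · rw [withDensityᵥ_apply hψ measurableSet_Ioc, integral_Iic_sub_integral_Iic hψ hab]
    · rw [withDensityᵥ_apply hψ measurableSet_Ioc, ← integral_Iic_sub_integral_Iic hψ hab, hvm,
        hWsub a b hab, ENNReal.ofReal_toReal
          (hk.mono (Icc_subset_Icc (clamp_mem hT a).1 (clamp_mem hT b).2))]
      change ‖F b - F a‖ₑ ≤ _
      rw [← hFclamp a, ← hFclamp b, ← edist_eq_enorm_sub]
      exact eVariationOn.edist_le F ⟨clamp_monotone T hab, le_rfl⟩ ⟨le_rfl, clamp_monotone T hab⟩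
  have heq : variationMeasure hk = m := by
    refine Measure.ext_of_Ioc _ _ fun a b hab => le_antisymm ?_ (hle _)
    rw [hvm]
    exact hWle a b hab.le
  refine ⟨heq, fun t ht => ?_⟩
  rw [← heq, hvm, hW, Function.comp_apply, Function.comp_apply, clamp_of_mem ht,
    clamp_of_mem ⟨le_rfl, hT⟩, variationFun_zero, sub_zero]
  exact (ENNReal.toReal_ofReal ENNReal.toReal_nonneg).symm

end Primitive

end SecondOrder

namespace SecondOrder

/-! ### Regularity of the constraints along feasible points and bounds on coefficients. -/

section ConstraintGeometry

lemma subset_fattening {E : Type*} [NormedAddCommGroup E] (T κ : ℝ) {S : Set (ℝ × E)} (hS : ∀ z ∈ S, z.1 ∈ Icc 0 T) :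
    S ⊆ fattening T κ S := fun z hz => ⟨hS z hz, z, hz, by simpa using sq_nonneg κ⟩

variable {E : Type*} [NormedAddCommGroup E] [InnerProductSpace ℝ E] [CompleteSpace E] {p : ℕ}
  {T : ℝ} {g : Fin p → ℝ → E → ℝ} {α β M κ ρ γ : ℝ}

namespace ConstraintAssumptions

variable (hg : ConstraintAssumptions T g α β M κ ρ γ) {t : ℝ} {x : E}
include hg

lemma contDiffWithinAt (i : Fin p) (ht : t ∈ Icc 0 T) (hx : x ∈ feasible g t) :
    ContDiffWithinAt ℝ 2 (fun y : ℝ × E => g i y.1 y.2) (Icc 0 T ×ˢ univ) (t, x) :=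
  hg.contDiff i (t, x) (subset_fattening T κ (fun _ hz => hz.1) ⟨ht, hx⟩)

lemma norm_gradient_bounds (i : Fin p) (ht : t ∈ Icc 0 T) (hx : x ∈ feasible g t) :
    α ≤ ‖gradient (g i t) x‖ ∧ ‖gradient (g i t) x‖ ≤ β :=
  hg.grad_bound i (t, x) (subset_fattening T κ (fun _ hz => hz.1) ⟨ht, hx i⟩)

lemma contDiffAt (i : Fin p) (ht : t ∈ Icc 0 T) (hx : x ∈ feasible g t) :
    ContDiffAt ℝ 2 (g i t) x := by
  have h := (hg.contDiffWithinAt i ht hx).comp (s := univ) x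
    (f := fun y : E => ((t, y) : ℝ × E)) (by fun_prop) (fun y _ => ⟨ht, mem_univ y⟩)
  exact contDiffWithinAt_univ.1 h

lemma continuousOn_constraint (i : Fin p) {q : ℝ → E} (hq : ContinuousOn q (Icc 0 T))
    (hmem : ∀ t ∈ Icc 0 T, q t ∈ feasible g t) :
    ContinuousOn (fun t => g i t (q t)) (Icc 0 T) := fun t ht =>
  (hg.contDiffWithinAt i ht (hmem t ht)).continuousWithinAt.comp (f := fun t => (t, q t))
    (continuousWithinAt_id.prodMk (hq t ht)) fun _ hs => ⟨hs, mem_univ _⟩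

/-- The slice `y ↦ (t, y)` stays in `[0, T] × E`, so even at the end times the full spatial
derivative is a restriction of the joint one-sided derivative. -/
lemma fderiv_slice_eq (i : Fin p) (ht : t ∈ Icc 0 T) (hx : x ∈ feasible g t) :
    fderiv ℝ (g i t) x = (fderivWithin ℝ (fun y : ℝ × E => g i y.1 y.2) (Icc 0 T ×ˢ univ)
      (t, x)).comp (ContinuousLinearMap.inr ℝ ℝ E) := by
  have h1 := ((hg.contDiffWithinAt i ht hx).differentiableWithinAt (by simp)).hasFDerivWithinAt
  have h2 : HasFDerivWithinAt (fun y : E => ((t, y) : ℝ × E)) (ContinuousLinearMap.inr ℝ ℝ E)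
      univ x := (hasFDerivAt_prodMk_right t x).hasFDerivWithinAt
  have h3 := h1.comp x h2 (fun y _ => ⟨ht, mem_univ y⟩)
  exact (hasFDerivWithinAt_univ.1 h3).fderiv

lemma continuousOn_gradient (hT : 0 < T) (i : Fin p) {q : ℝ → E} (hq : ContinuousOn q (Icc 0 T))
    (hmem : ∀ t ∈ Icc 0 T, q t ∈ feasible g t) :
    ContinuousOn (fun t => gradient (g i t) (q t)) (Icc 0 T) := by
  have hU : UniqueDiffOn ℝ (Icc 0 T ×ˢ (univ : Set E)) := (uniqueDiffOn_Icc hT).prod uniqueDiffOn_univ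
  refine (InnerProductSpace.toDual ℝ E).symm.continuous.comp_continuousOn ?_
  have h : ContinuousOn (fun t => (fderivWithin ℝ (fun y : ℝ × E => g i y.1 y.2)
      (Icc 0 T ×ˢ univ) (t, q t)).comp (ContinuousLinearMap.inr ℝ ℝ E)) (Icc 0 T) := by
    refine ContinuousOn.clm_comp (fun t ht => ?_) continuousOn_const
    have h1 := ((hg.contDiffWithinAt i ht (hmem t ht)).fderivWithin_right (m := 1) hU
      (by norm_num) ⟨ht, mem_univ _⟩).continuousWithinAt
    exact h1.comp (f := fun t => (t, q t))
      (continuousWithinAt_id.prodMk (hq t ht)) fun _ hs => ⟨hs, mem_univ _⟩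
  exact h.congr fun t ht => hg.fderiv_slice_eq i ht (hmem t ht)

/-- A zero at an interior point would be a local minimum of `g i t`, with vanishing gradient,
against `α ≤ |∇g_i|`. -/
lemma ne_zero_of_mem_interior (i : Fin p) (ht : t ∈ Icc 0 T)
    (hx : x ∈ interior (feasible g t)) : g i t x ≠ 0 := by
  intro h0
  have hmin : IsLocalMin (g i t) x := by
    filter_upwards [isOpen_interior.mem_nhds hx] with y hy
    rw [h0]
    exact interior_subset hy i
  have h1 := (hg.norm_gradient_bounds i ht (interior_subset hx)).1
  rw [gradient, hmin.fderiv_eq_zero, map_zero, norm_zero] at h1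
  exact absurd hg.α_pos (not_lt.2 h1)

/-- The reverse triangle inequality bounds the coefficients of a combination of active
gradients. -/
lemma mul_coeff_le (ht : t ∈ Icc 0 T) (hx : x ∈ feasible g t) {c : Fin p → ℝ}
    (hc : ∀ i, 0 ≤ c i) (hact : ∀ i, g i t x ≠ 0 → c i = 0) (i : Fin p) :
    c i * α ≤ γ * ‖∑ i, c i • gradient (g i t) x‖ := by
  have h := hg.reverse_triangle t ht x hx c hc
  -- Active indices satisfy `g i t x = 0 ≤ ρ`, so restricting to `I_ρ` drops only zero terms.
  have hsum : ∑ i with g i t x ≤ ρ, c i • gradient (g i t) x =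
      ∑ i, c i • gradient (g i t) x :=
    Finset.sum_filter_of_ne fun j _ hj => by
      by_contra hρ
      refine hj ?_
      rw [hact j fun h0 => hρ (h0 ▸ hg.ρ_pos.le), zero_smul]
  have hsum' : ∑ i with g i t x ≤ ρ, c i * ‖gradient (g i t) x‖ =
      ∑ i, c i * ‖gradient (g i t) x‖ :=
    Finset.sum_filter_of_ne fun j _ hj => by
      by_contra hρ
      refine hj ?_
      rw [hact j fun h0 => hρ (h0 ▸ hg.ρ_pos.le), zero_mul]
  rw [hsum, hsum'] at h
  calc c i * α ≤ c i * ‖gradient (g i t) x‖ :=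
        mul_le_mul_of_nonneg_left (hg.norm_gradient_bounds i ht hx).1 (hc i)
    _ ≤ ∑ i, c i * ‖gradient (g i t) x‖ :=
        Finset.single_le_sum (f := fun i => c i * ‖gradient (g i t) x‖)
          (fun j _ => mul_nonneg (hc j) (norm_nonneg _)) (Finset.mem_univ i)
    _ ≤ _ := h

/-- Proximal normals of norm at most one are combinations of the opposite active gradients with
uniformly bounded coefficients. -/
lemma exists_coeff_of_mem_proxNormalCone (ht : t ∈ Icc 0 T) {v : E}
    (hv : v ∈ proxNormalCone (feasible g t) x) (hv1 : ‖v‖ ≤ 1) :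
    ∃ c : Fin p → ℝ, (∀ i, 0 ≤ c i) ∧ (∀ i, c i ≤ γ / α) ∧ (∀ i, g i t x ≠ 0 → c i = 0) ∧
      -v = ∑ i, c i • gradient (g i t) x := by
  have hx := mem_of_mem_proxNormalCone hv
  obtain ⟨c, h1, h2, h3⟩ := exists_eq_neg_sum_of_mem_proxNormalCone (g := fun i => g i t) (x := x)
    (fun i => (hg.contDiffAt i ht hx).differentiableAt (by simp))
    (fun c hc hact h0 => by
      funext i
      have h := hg.mul_coeff_le ht hx hc hact i
      rw [h0, norm_zero, mul_zero] at h
      exact le_antisymm (nonpos_of_mul_nonpos_left h hg.α_pos) (hc i)) hv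
  refine ⟨c, h1, fun i => ?_, h2, by rw [h3, neg_neg]⟩
  rw [le_div_iff₀ hg.α_pos]
  refine (hg.mul_coeff_le ht hx h1 h2 i).trans ?_
  rw [← norm_neg, ← h3]
  exact mul_le_of_le_one_right hg.γ_pos.le hv1

end ConstraintAssumptions

end ConstraintGeometry

/-! ### Changes of density for vector measures. -/

section Densities

variable {E : Type*} [NormedAddCommGroup E] [NormedSpace ℝ E]

lemma withDensityᵥ_finset_sum {ι : Type*} (s : Finset ι) {μ : Measure ℝ} {φ : ι → ℝ → E}
    (h : ∀ i, Integrable (φ i) μ) :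
    μ.withDensityᵥ (fun x => ∑ i ∈ s, φ i x) = ∑ i ∈ s, μ.withDensityᵥ (φ i) := by
  classical
  induction s using Finset.induction_on with
  | empty =>
    simp only [Finset.sum_empty]
    exact withDensityᵥ_zero
  | insert i s hi ih =>
    simp_rw [Finset.sum_insert hi]
    rw [withDensityᵥ_add' (h i) (integrable_finsetSum s fun i _ => h i), ih]

/-- A finite measure dominated by `ν` and carried by `H` has a density supported by `H`. -/
lemma exists_density_of_le {lam ν : Measure ℝ} [IsFiniteMeasure lam] [IsFiniteMeasure ν]
    (hle : lam ≤ ν) {H : Set ℝ} (hH : MeasurableSet H) (h0 : lam Hᶜ = 0) :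
    ∃ a : ℝ → ℝ, Measurable a ∧ (∀ s, 0 ≤ a s) ∧ (∀ s ∉ H, a s = 0) ∧
      lam = ν.withDensity fun s => ENNReal.ofReal (a s) := by
  refine ⟨H.indicator fun s => (lam.rnDeriv ν s).toReal,
    (Measure.measurable_rnDeriv _ _).ennreal_toReal.indicator hH,
    fun s => indicator_nonneg (fun _ _ => ENNReal.toReal_nonneg) s,
    fun s hs => indicator_of_notMem hs _, ?_⟩
  have h1 : lam = lam.restrict H := (Measure.restrict_eq_self_of_ae_mem h0).symm
  have h2 : ν.withDensity (lam.rnDeriv ν) = lam :=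
    Measure.withDensity_rnDeriv_eq _ _ (Measure.absolutelyContinuous_of_le hle)
  have h3 : lam = ν.withDensity (H.indicator (lam.rnDeriv ν)) := by
    rw [withDensity_indicator hH, ← restrict_withDensity hH, h2, ← h1]
  conv_lhs => rw [h3]
  refine withDensity_congr_ae ?_
  filter_upwards [Measure.rnDeriv_lt_top lam ν] with s hs
  by_cases hsH : s ∈ H
  · simp [hsH, hs.ne]
  · simp [hsH]

variable [MeasurableSpace E] [BorelSpace E] [SecondCountableTopology E]

/-- Passing from measures `a i • μ` with densities `V i` to the measure `μ` with density
`∑ a i • V i`. -/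
lemma sum_withDensityᵥ_withDensity {ι : Type*} [Fintype ι] {μ : Measure ℝ} {a : ι → ℝ → ℝ}
    (ha : ∀ i, Measurable (a i)) (ha0 : ∀ i s, 0 ≤ a i s) {I : Set ℝ} (hI : MeasurableSet I)
    (haI : ∀ i, ∀ s ∉ I, a i s = 0)
    (hfin : ∀ i, IsFiniteMeasure (μ.withDensity fun s => ENNReal.ofReal (a i s)))
    {V : ι → ℝ → E} (hV : ∀ i, Measurable (I.indicator (V i))) {C : ℝ}
    (hC : ∀ i s, ‖I.indicator (V i) s‖ ≤ C) :
    Integrable (fun s => ∑ i, a i s • I.indicator (V i) s) μ ∧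
      ∑ i, (μ.withDensity fun s => ENNReal.ofReal (a i s)).withDensityᵥ (V i) =
        μ.withDensityᵥ fun s => ∑ i, a i s • I.indicator (V i) s := by
  have hint : ∀ i, Integrable (fun s => a i s • I.indicator (V i) s) μ := fun i => by
    have h1 : Integrable (I.indicator (V i)) (μ.withDensity fun s => ENNReal.ofReal (a i s)) :=
      Integrable.of_bound (hV i).aestronglyMeasurable C (Eventually.of_forall (hC i))
    have h2 := (integrable_withDensity_iff_integrable_smul' (ha i).ennreal_ofReal
      (Eventually.of_forall fun _ => ENNReal.ofReal_lt_top)).1 h1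
    simpa only [ENNReal.toReal_ofReal (ha0 i _)] using h2
  refine ⟨integrable_finsetSum _ fun i _ => hint i, ?_⟩
  rw [withDensityᵥ_finset_sum _ hint]
  refine Finset.sum_congr rfl fun i _ => ?_
  have h1 := withDensityᵥ_smul_eq_withDensityᵥ_withDensity' (μ := μ)
    (f := fun s => ENNReal.ofReal (a i s)) (g := I.indicator (V i)) (ha i).ennreal_ofReal.aemeasurable
    (Eventually.of_forall fun _ => ENNReal.ofReal_lt_top)
    (by simpa only [ENNReal.toReal_ofReal (ha0 i _)] using hint i)
  simp only [ENNReal.toReal_ofReal (ha0 i _)] at h1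
  rw [h1]
  refine WithDensityᵥEq.congr_ae ?_
  -- The weighted measures do not charge the complement of `I`, so truncating `V i` to `I` is
  -- harmless.
  have h2 : (μ.withDensity fun s => ENNReal.ofReal (a i s)) Iᶜ = 0 := by
    rw [withDensity_apply _ hI.compl]
    refine (setLIntegral_congr_fun hI.compl fun s hs => ?_).trans lintegral_zero
    simp [haI i s hs]
  have h3 : ∀ᵐ s ∂(μ.withDensity fun s => ENNReal.ofReal (a i s)), s ∈ I := h2
  filter_upwards [h3] with s hs
  rw [indicator_of_mem hs]

end Densities

end SecondOrder

namespace SecondOrder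

/-! ### The two implications. -/

section Equivalence

variable {E : Type*} [NormedAddCommGroup E] [InnerProductSpace ℝ E] [CompleteSpace E] {p : ℕ}
  {T : ℝ} {g : Fin p → ℝ → E → ℝ} {α β M κ ρ γ : ℝ} {f : ℝ → E → E} {q₀ u₀ : E} {q u : ℝ → E}

/-- The times at which the `i`-th constraint is active. -/
def activeTimes (T : ℝ) (g : Fin p → ℝ → E → ℝ) (q : ℝ → E) (i : Fin p) : Set ℝ :=
  {t | t ∈ Icc 0 T ∧ g i t (q t) = 0}

namespace ConstraintAssumptions

variable (hg : ConstraintAssumptions T g α β M κ ρ γ)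
include hg

lemma isClosed_activeTimes (hq : ContinuousOn q (Icc 0 T))
    (hmem : ∀ t ∈ Icc 0 T, q t ∈ feasible g t) (i : Fin p) :
    IsClosed (activeTimes T g q i) :=
  (hg.continuousOn_constraint i hq hmem).preimage_isClosed_of_isClosed isClosed_Icc
    isClosed_singleton

lemma norm_indicator_gradient_le (hmem : ∀ t ∈ Icc 0 T, q t ∈ feasible g t) (i : Fin p) (t : ℝ) :
    ‖(Icc 0 T).indicator (fun t => gradient (g i t) (q t)) t‖ ≤ β := by
  by_cases ht : t ∈ Icc 0 T
  · rw [indicator_of_mem ht]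
    exact (hg.norm_gradient_bounds i ht (hmem t ht)).2
  · rw [indicator_of_notMem ht, norm_zero]
    exact hg.β_pos.le

variable [MeasurableSpace E] [BorelSpace E]

lemma measurable_indicator_gradient (hT : 0 < T) (hq : ContinuousOn q (Icc 0 T))
    (hmem : ∀ t ∈ Icc 0 T, q t ∈ feasible g t) (i : Fin p) :
    Measurable ((Icc 0 T).indicator fun t => gradient (g i t) (q t)) := by
  classical
  have h := (hg.continuousOn_gradient hT i hq hmem).measurable_piecewise
    (continuousOn_const (c := (0 : E))) measurableSet_Icc
  exact (piecewise_eq_indicator (s := Icc 0 T) (f := fun t => gradient (g i t) (q t))) ▸ h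

variable [SecondCountableTopology E]

/-- A solution of the differential inclusion has Kuhn–Tucker multipliers. -/
lemma exists_isKuhnTuckerSolution (hT : 0 < T)
    (h : IsInclusionSolution T (feasible g) f q₀ u₀ q u) :
    ∃ lam : Fin p → Measure ℝ, IsKuhnTuckerSolution T g f q₀ u₀ q u lam := by
  obtain ⟨k, ξ, hk, hbal, hξm, hξN, hξ1, hkξ⟩ := h.reaction
  have hmem : ∀ t ∈ Icc 0 T, q t ∈ feasible g t := fun t ht =>
    mem_of_mem_proxNormalCone (hξN t ht)
  have hq := h.continuousOn
  set μ := variationMeasure hk with hμdef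
  -- The formula for `|k|(T)` integrates an indicator over `(0, T]`, so `|k|(T)` is at most the mass
  -- of `(0, T]`: there is no atom at `0`.
  have hμ : μ (Ioc 0 T)ᶜ = 0 := by
    refine variationMeasure_compl_Ioc hT.le hk ?_
    rw [(hkξ T ⟨hT.le, le_rfl⟩).1, intervalIntegral.integral_of_le hT.le]
    refine (le_abs_self _).trans ?_
    have h1 := norm_setIntegral_le_of_norm_le_const (μ := μ) (s := Ioc 0 T) (C := 1)
      (f := {s | q s ∈ frontier (feasible g s)}.indicator fun _ => (1 : ℝ))
      (measure_lt_top _ _) fun s _ => (norm_indicator_le_norm_self _ _).trans (by simp)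
    rwa [one_mul] at h1
  have hξint : Integrable ξ μ := Integrable.of_bound hξm.aestronglyMeasurable 1
    (hξ1.mono fun s hs => hs.le)
  have hdk : differentialMeasure hk = μ.withDensityᵥ ξ :=
    differentialMeasure_eq_withDensity hT.le hμ hξint (fun t ht => by
      rw [(hkξ t ht).2, intervalIntegral.integral_of_le ht.1]) hk
  -- Off this set of full measure `ξ` may be large and the bound `γ / α` fails; there `-ξ` is
  -- replaced by `0`.
  let A : Set ℝ := Icc 0 T ∩ {s | ‖ξ s‖ = 1}
  have hA : MeasurableSet A :=
    measurableSet_Icc.inter (measurableSet_eq_fun hξm.norm measurable_const)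
  have hAae : ∀ᵐ s ∂μ, s ∈ A := by
    have h1 : ∀ᵐ s ∂μ, s ∈ Ioc 0 T := hμ
    filter_upwards [h1, hξ1] with s h1 h2
    exact ⟨Ioc_subset_Icc_self h1, h2⟩
  let G : Fin p → ℝ → E := fun i => (Icc 0 T).indicator fun t => gradient (g i t) (q t)
  have hGm : ∀ i, Measurable (G i) := hg.measurable_indicator_gradient hT hq hmem
  have hclosed := hg.isClosed_activeTimes hq hmem
  obtain ⟨a, ham, ha0, haC, haH, hsum⟩ := exists_measurable_coeff hGm
    (η := A.indicator fun s => -ξ s) (hξm.neg.indicator hA) (A := activeTimes T g q)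
    (fun i => (hclosed i).measurableSet) (C := γ / α) (fun s => by
      by_cases hs : s ∈ A
      · obtain ⟨c, h1, h2, h3, h4⟩ := hg.exists_coeff_of_mem_proxNormalCone hs.1 (hξN s hs.1)
          (le_of_eq hs.2)
        refine ⟨c, h1, h2, fun i hi => h3 i fun h0 => hi ⟨hs.1, h0⟩, ?_⟩
        rw [indicator_of_mem hs, h4]
        exact Finset.sum_congr rfl fun i _ => by simp only [G, indicator_of_mem hs.1]
      · exact ⟨0, fun _ => le_rfl, fun _ => div_nonneg hg.γ_pos.le hg.α_pos.le, fun _ _ => rfl,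
          by simp [hs]⟩)
  have hfin : ∀ i, IsFiniteMeasure (μ.withDensity fun s => ENNReal.ofReal (a i s)) := fun i =>
    isFiniteMeasure_withDensity_ofReal (Integrable.of_bound (ham i).aestronglyMeasurable (γ / α)
      (Eventually.of_forall fun s => by
        rw [Real.norm_of_nonneg (ha0 i s)]
        exact haC i s)).2
  obtain ⟨-, hlam⟩ := sum_withDensityᵥ_withDensity ham ha0 measurableSet_Icc
    (fun i s hs => haH i s fun h => hs h.1) hfin hGm (hg.norm_indicator_gradient_le hmem)
  refine ⟨fun i => μ.withDensity fun s => ENNReal.ofReal (a i s),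
    { toIsTrajectory := h.toIsTrajectory
      toImpactAndInitial := h.toImpactAndInitial
      force := h.force
      finite := hfin
      mem := hmem
      balance := ?_
      support := fun i => ?_ }⟩
  · rw [hlam, ← hbal, hdk, add_assoc, left_eq_add]
    have h1 : μ.withDensityᵥ (fun s => ∑ i, a i s • G i s) = μ.withDensityᵥ fun s => -ξ s := by
      refine WithDensityᵥEq.congr_ae ?_
      filter_upwards [hAae] with s hs
      rw [← hsum s, indicator_of_mem hs]
    rw [h1, withDensityᵥ_neg', add_neg_cancel]
  · refine Measure.support_subset_of_isClosed (hclosed i) ?_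
    change activeTimes T g q i ∈ _
    rw [mem_ae_iff, withDensity_apply _ (hclosed i).measurableSet.compl]
    refine (setLIntegral_congr_fun (hclosed i).measurableSet.compl fun s hs => ?_).trans
      lintegral_zero
    simp [haH i s hs]

/-- A solution of the Kuhn–Tucker problem solves the differential inclusion. -/
lemma isInclusionSolution (hT : 0 < T) (hq₀ : q₀ ∈ interior (feasible g 0))
    {lam : Fin p → Measure ℝ} (h : IsKuhnTuckerSolution T g f q₀ u₀ q u lam) :
    IsInclusionSolution T (feasible g) f q₀ u₀ q u := by
  have hmem := h.mem
  have hq := h.continuousOn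
  have hlamfin := h.finite
  have hclosed := hg.isClosed_activeTimes hq hmem
  have hactive : ∀ i, ∀ t ∈ activeTimes T g q i, q t ∉ interior (feasible g t) :=
    fun i t ht hint => hg.ne_zero_of_mem_interior i ht.1 hint ht.2
  have hlamH : ∀ i, lam i (activeTimes T g q i)ᶜ = 0 := fun i =>
    measure_mono_null (compl_subset_compl.2 (h.support i)) Measure.measure_compl_support
  -- Time `0` is excluded because `q₀` is interior, where no constraint is active.
  have hHsub : ∀ i, activeTimes T g q i ⊆ Ioc 0 T := fun i t ht =>
    ⟨lt_of_le_of_ne ht.1.1 fun h0 => hactive i t ht (by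
      rw [← h0, h.initial_pos]
      exact hq₀), ht.1.2⟩
  set ν : Measure ℝ := ∑ i, lam i with hνdef
  have hνfin : IsFiniteMeasure ν := inferInstance
  have hle : ∀ i, lam i ≤ ν := fun i =>
    Finset.single_le_sum (f := lam) (fun j _ => Measure.zero_le _) (Finset.mem_univ i)
  have hν : ν (Ioc 0 T)ᶜ = 0 := by
    rw [hνdef, Measure.finsetSum_apply]
    exact Finset.sum_eq_zero fun i _ =>
      measure_mono_null (compl_subset_compl.2 (hHsub i)) (hlamH i)
  choose a ham ha0 haH hlama using fun i =>
    exists_density_of_le (hle i) (hclosed i).measurableSet (hlamH i)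
  let G : Fin p → ℝ → E := fun i => (Icc 0 T).indicator fun t => gradient (g i t) (q t)
  have hGm : ∀ i, Measurable (G i) := hg.measurable_indicator_gradient hT hq hmem
  obtain ⟨hsint, hlam⟩ := sum_withDensityᵥ_withDensity ham ha0 measurableSet_Icc
    (fun i s hs => haH i s fun h => hs h.1) (fun i => hlama i ▸ hlamfin i) hGm
    (hg.norm_indicator_gradient_le hmem)
  simp_rw [← hlama] at hlam
  set ψ : ℝ → E := fun s => -∑ i, a i s • G i s with hψdef
  have hψm : Measurable ψ :=
    (Finset.measurable_fun_sum _ fun i _ => (ham i).smul (hGm i)).neg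
  have hψint : Integrable ψ ν := hsint.neg
  have hψN : ∀ s ∈ Icc 0 T, ∀ r : ℝ, 0 ≤ r → r • ψ s ∈ proxNormalCone (feasible g s) (q s) := by
    intro s hs r hr
    have h1 := neg_sum_mem_proxNormalCone (g := fun i => g i s) (x := q s) (hmem s hs)
      (fun i => hg.contDiffAt i hs (hmem s hs)) (c := fun i => r * a i s)
      (fun i => mul_nonneg hr (ha0 i s))
      (fun i hi => by rw [haH i s fun h => hi h.2, mul_zero])
    convert! h1 using 1
    simp only [hψdef, G, indicator_of_mem hs, smul_neg, Finset.smul_sum, mul_smul]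
  have hψfront : ∀ s, ψ s ≠ 0 → q s ∈ frontier (feasible g s) := by
    intro s hs
    obtain ⟨i, hi⟩ : ∃ i, a i s ≠ 0 := by
      by_contra! h0
      exact hs (by simp [hψdef, h0])
    have hi' : s ∈ activeTimes T g q i := by
      by_contra hn
      exact hi (haH i s hn)
    exact ⟨subset_closure (hmem s hi'.1), hactive i s hi'⟩
  let k : ℝ → E := fun t => ∫ s in Iic t, ψ s ∂ν
  have hk : BoundedVariationOn k (Icc 0 T) := boundedVariationOn_integral_Iic hψint 0 T
  obtain ⟨hvm, hvf⟩ := variationMeasure_eq_withDensity hT.le hν hψint hk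
  have hkIoc : ∀ t, k t = ∫ s in Ioc 0 t, ψ s ∂ν := fun t => by
    refine setIntegral_congr_set ?_
    have h1 : ∀ᵐ s ∂ν, s ∈ Ioc 0 T := hν
    filter_upwards [h1] with s hs
    exact propext ⟨fun h => ⟨hs.1, h⟩, fun h => h.2⟩
  -- `d|k| = |ψ| ν` does not charge the zeros of `ψ`.
  have hae : ∀ᵐ s ∂variationMeasure hk, ψ s ≠ 0 := by
    rw [hvm, ae_withDensity_iff hψm.enorm]
    exact Eventually.of_forall fun s hs => by simpa using hs
  refine
    { toIsTrajectory := h.toIsTrajectory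
      toImpactAndInitial := h.toImpactAndInitial
      force := h.force
      -- Where `ψ` vanishes the quotient is `0`, still a proximal normal since `q s` is feasible; so
      -- membership in the cone holds at every time, not just almost everywhere.
      reaction := ⟨k, fun s => ‖ψ s‖⁻¹ • ψ s, hk, ?_, hψm.norm.inv.smul hψm,
        fun s hs => hψN s hs _ (inv_nonneg.2 (norm_nonneg _)), ?_, fun t ht => ⟨?_, ?_⟩⟩ }
  · rw [h.balance, hlam, differentialMeasure_eq_withDensity hT.le hν hψint (fun t _ => hkIoc t) hk,
      add_assoc, hψdef, withDensityᵥ_neg', add_neg_cancel, add_zero]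
  · filter_upwards [hae] with s hs
    rw [norm_smul, norm_inv, norm_norm, inv_mul_cancel₀ (norm_ne_zero_iff.2 hs)]
  · rw [hvf t ht, intervalIntegral.integral_of_le ht.1, ← hvm]
    have h1 : ∫ s in Ioc 0 t, {s | q s ∈ frontier (feasible g s)}.indicator (fun _ => (1 : ℝ)) s
        ∂variationMeasure hk = ∫ s in Ioc 0 t, (1 : ℝ) ∂variationMeasure hk := by
      refine setIntegral_congr_ae measurableSet_Ioc ?_
      filter_upwards [hae] with s hs _
      exact indicator_of_mem (s := {s | q s ∈ frontier (feasible g s)}) (hψfront s hs) _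
    rw [h1, setIntegral_const, smul_eq_mul, mul_one, measureReal_def]
  · rw [hkIoc, intervalIntegral.integral_of_le ht.1, hvm,
      setIntegral_withDensity_eq_setIntegral_toReal_smul hψm.enorm
        (Eventually.of_forall fun _ => enorm_lt_top) _ measurableSet_Ioc]
    refine setIntegral_congr_fun measurableSet_Ioc fun s _ => ?_
    rcases eq_or_ne (ψ s) 0 with h0 | h0
    · simp [h0]
    · rw [toReal_enorm, smul_smul, mul_inv_cancel₀ (norm_ne_zero_iff.2 h0), one_smul]

end ConstraintAssumptions

end Equivalence

end SecondOrder

theorem mainTheorem9 {d p : ℕ} (T : ℝ) (hT : 0 < T)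
    (g : Fin p → ℝ → EuclideanSpace ℝ (Fin d) → ℝ) (α β M κ ρ γ : ℝ)
    (hg : SecondOrder.ConstraintAssumptions T g α β M κ ρ γ)
    (f : ℝ → EuclideanSpace ℝ (Fin d) → EuclideanSpace ℝ (Fin d))
    (q₀ u₀ : EuclideanSpace ℝ (Fin d)) (hq₀ : q₀ ∈ interior (SecondOrder.feasible g 0))
    (q u : ℝ → EuclideanSpace ℝ (Fin d)) :
    SecondOrder.IsInclusionSolution T (SecondOrder.feasible g) f q₀ u₀ q u ↔
      ∃ lam : Fin p → MeasureTheory.Measure ℝ,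
        SecondOrder.IsKuhnTuckerSolution T g f q₀ u₀ q u lam :=
  ⟨fun h => hg.exists_isKuhnTuckerSolution hT h,
    fun ⟨_, h⟩ => hg.isInclusionSolution hT hq₀ h⟩
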